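/- **Polynomials.** On polynomials in $t$ over $\mathbb Z[q]$ let $(Df)(t)=\frac{f(qt)-f(t)}{(q-1)t}$ and let $U$ be multiplication by $t$. For $n\ge 0$ put $Q_n(t,q)=(D+UDU)^n 1$ and $R_n(t,q)=(D+DUU)^n 1$. **Snakes.** A signed permutation of $[n]$ is a bijection $\sigma$ of $\{\pm1,\dots,\pm n\}$ with $\sigma(-i)=-\sigma(i)$; write $\sigma_i=\sigma(i)$. It is a snake if $\sigma_1>\sigma_2<\sigma_3>\cdots\sigma_n$. Let $\mathcal S^0_n$ be the set of snakes of size $n$ with $\sigma_1>0$ (for $n=0$, the empty snake), and let $\mathcal S^{00}_n$ be the set of those which also satisfy $(-1)^n\sigma_n<0$. Put $\sigma_0=0$ in both cases, and $\sigma_{n+1}=(-1)^n(n+1)$ if $\sigma\in\mathcal S^0_n$, $\sigma_{n+1}=0$ if $\sigma\in\mathcal S^{00}_n$. Let $\mathsf{cs}(\sigma)=\#\{0\le i\le n:\sigma_i\sigma_{i+1}<0\}$. **Statistics.** Let $\pi=|\sigma|$, i.e. $\pi_i=|\sigma_i|$ for $0\le i\le n+1$. For $1\le i\le n$ let $$\mathsf{13\text-2}(\pi,i)=\#\{0\le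 j<i-1:\pi_j<\pi_i<\pi_{j+1}\},\qquad \mathsf{2\text-31}(\pi,i)=\#\{i<j\le n:\pi_j>\pi_i>\pi_{j+1}\},$$ $s_i=\mathsf{13\text-2}(\pi,i)+\mathsf{2\text-31}(\pi,i)$ and $\mathsf{2\text-31}(\pi)=\sum_{i=1}^n\mathsf{2\text-31}(\pi,i)$. The position $i\in[n]$ is a valley if $\pi_{i-1}>\pi_i<\pi_{i+1}$, a double ascent if $\pi_{i-1}<\pi_i<\pi_{i+1}$, a double descent if $\pi_{i-1}>\pi_i>\pi_{i+1}$, a peak if $\pi_{i-1}<\pi_i>\pi_{i+1}$. Let $X$ be the set of valleys $i$ with $\sigma_{i-1}\sigma_i<0$ and $\sigma_i\sigma_{i+1}<0$, $Y$ the set of double ascents and double descents, $Z$ the set of peaks. Define $$\mathsf{pat}_Q(\sigma)=\sum_{i\in X}2s_i-\#X+\sum_{i\in Y}s_i,\qquad \mathsf{pat}_R(\sigma)=\sum_{i\in X}2(s_i-1)+\sum_{i\in Y}s_i+\#Z .$$ A block of $\pi$ restricted to $\{0,\dots,k\}$ is a maximal run of consecutive entries of $\pi_0\pi_1\cdots\pi_{n+1}$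 that are all at most $k$; let $\alpha(k)$ be the number of these blocks and, for $1\le k\le n$, let $\beta(k)$ be the number of them to the right of the block that contains the element $k$. **Paths.** A bicolored Motzkin path of length $n$ runs from $(0,0)$ to $(n,0)$ without going below the $x$-axis, with steps $\mathsf U=(1,1)$, $\mathsf D=(1,-1)$ and two kinds of level steps $\mathsf L$ (straight), $\mathsf W$ (wavy) equal to $(1,0)$; the height of a step is the ordinate of its starting point. In a weighted path each step $z$ carries a monomial $\rho(z)$ in $t,q$, and the weight $\rho$ of the path is the product of these. Let $\mathcal T^*_n$ be the set of weighted bicolored Motzkin paths of length $n$ in which a step at height $h$ has weight in - $\mathsf U$: $\{1,q,\dots,q^h\}\cup\{t^2q^{2h+1},\dots,t^2q^{3h+1}\}$; - $\mathsf L$: $\{tq^h,\dots,tq^{2h}\}$; - $\mathsf W$: $\{tq^h,\dots,tq^{2h-1}\}$, with $h\ge1$; - $\mathsf D$: $\{1,\dots,q^{h-1}\}$; and let $\mathcal T_n$ be the set of those in which a step at height $h$ has weight in - $\mathsf U$: $\{1,q,\dots,q^h\}\cup\{t^2q^{2h+2},\dots,t^2q^{3h+2}\}$; - $\mathsf L$: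 $\{tq^{h+1},\dots,tq^{2h+1}\}$; - $\mathsf W$: $\{tq^h,\dots,tq^{2h}\}$; - $\mathsf D$: $\{1,\dots,q^{h}\}$. **Maps.** For $\sigma\in\mathcal S^0_n$ let $\Lambda_1(\sigma)=z_1\cdots z_n$, and for $\sigma\in\mathcal S^{00}_{n+1}$ let $\Lambda_2(\sigma)=z_1\cdots z_n$, where $z_j$ depends on the position $i$ with $|\sigma_i|=j$ as follows; $\alpha=\alpha(j)$, $\beta=\beta(j)$. - If $i$ is a valley, $z_j=\mathsf U$; its weight is $q^{\beta}$ for $\Lambda_1$ and $q^{\beta-1}$ for $\Lambda_2$ if $i\notin X$, and $t^2q^{\beta+2\alpha-3}$ for $\Lambda_1$ and $t^2q^{\beta+2\alpha-5}$ for $\Lambda_2$ if $i\in X$. - If $i$ is a double ascent, $z_j=\mathsf L$, and if $i$ is a double descent, $z_j=\mathsf W$; the weight is $tq^{\beta+\alpha-1}$ for $\Lambda_1$ and $tq^{\beta+\alpha-2}$ for $\Lambda_2$. - If $i$ is a peak, $z_j=\mathsf D$ with weight $q^{\beta}$. **Theorem.** Let $n\ge0$. 1. $\Lambda_1$ is a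 bijection from $\mathcal S^0_n$ onto $\mathcal T^*_n$ with $\rho(\Lambda_1(\sigma))=t^{\mathsf{cs}(\sigma)}q^{\mathsf{2\text-31}(|\sigma|)+\mathsf{pat}_Q(\sigma)}$ for all $\sigma\in\mathcal S^0_n$; these exponents of $q$ are nonnegative, and $$Q_n(t,q)=\sum_{\sigma\in\mathcal S^0_n}t^{\mathsf{cs}(\sigma)}q^{\mathsf{2\text-31}(|\sigma|)+\mathsf{pat}_Q(\sigma)} .$$ 2. $\Lambda_2$ is a bijection from $\mathcal S^{00}_{n+1}$ onto $\mathcal T_n$ with $\rho(\Lambda_2(\sigma))=t^{\mathsf{cs}(\sigma)}q^{\mathsf{2\text-31}(|\sigma|)+\mathsf{pat}_R(\sigma)-n-1}$ for all $\sigma\in\mathcal S^{00}_{n+1}$; these exponents of $q$ are nonnegative, and $$R_n(t,q)=\sum_{\sigma\in\mathcal S^{00}_{n+1}}t^{\mathsf{cs}(\sigma)}q^{\mathsf{2\text-31}(|\sigma|)+\mathsf{pat}_R(\sigma)-n-1} .$$ -/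

import Mathlib

/-! ### The polynomials `Q_n(t,q)` and `R_n(t,q)`

Polynomials in `t` with coefficients in `ℤ[q]` are elements of `Polynomial (Polynomial ℤ)`:
the outer variable is `t`, the inner one is `q`. -/

namespace SnakeEuler

open Finset

/-- The variable `t`. -/
noncomputable def tVar : Polynomial (Polynomial ℤ) := Polynomial.X

/-- The variable `q`. -/
noncomputable def qVar : Polynomial (Polynomial ℤ) := Polynomial.C Polynomial.X

/-- `f(qt) - f(t)` is divisible by `(q-1)t`. -/
theorem dvd_dilate_sub (f : Polynomial (Polynomial ℤ)) :
    (qVar - 1) * tVar ∣ f.comp (qVar * tVar) - f := by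
  induction f using Polynomial.induction_on' with
  | add f g hf hg =>
    have h := dvd_add hf hg
    rw [Polynomial.add_comp]
    convert h using 1
    ring
  | monomial n a =>
    rw [Polynomial.monomial_comp, ← Polynomial.C_mul_X_pow_eq_monomial]
    change _ ∣ Polynomial.C a * (qVar * tVar) ^ n - Polynomial.C a * tVar ^ n
    have e : Polynomial.C a * (qVar * tVar) ^ n - Polynomial.C a * tVar ^ n
        = Polynomial.C a * ((qVar ^ n - 1) * tVar ^ n) := by ring
    rw [e]
    apply Dvd.dvd.mul_left
    rcases n with _ | n
    · simp
    · apply mul_dvd_mul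
      · simpa using sub_dvd_pow_sub_pow qVar 1 (n + 1)
      · exact dvd_pow_self _ (Nat.succ_ne_zero n)

/-- The `q`-derivative `(D f)(t) = (f(qt) - f(t)) / ((q-1)t)`, an exact quotient in `ℤ[q][t]`. -/
noncomputable def qDeriv (f : Polynomial (Polynomial ℤ)) : Polynomial (Polynomial ℤ) :=
  (dvd_dilate_sub f).choose

/-- `qDeriv f` is indeed the quotient (it is unique, as `ℤ[q][t]` is an integral domain). -/
theorem qDeriv_spec (f : Polynomial (Polynomial ℤ)) :
    f.comp (qVar * tVar) - f = (qVar - 1) * tVar * qDeriv f :=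
  (dvd_dilate_sub f).choose_spec

/-- `Q_n(t,q) = (D + UDU)^n 1`, with `U` the multiplication by `t`. -/
noncomputable def polyQ (n : ℕ) : Polynomial (Polynomial ℤ) :=
  (fun f => qDeriv f + tVar * qDeriv (tVar * f))^[n] 1

/-- `R_n(t,q) = (D + DUU)^n 1`, with `U` the multiplication by `t`. -/
noncomputable def polyR (n : ℕ) : Polynomial (Polynomial ℤ) :=
  (fun f => qDeriv f + qDeriv (tVar * (tVar * f)))^[n] 1

/-! ### Signed permutations and snakes -/

/-- `[±n] = {-n, …, -1, 1, …, n}`. -/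
noncomputable def signedRange (n : ℕ) : Finset ℤ := (Finset.Icc (-(n : ℤ)) (n : ℤ)).erase 0

/-- Signed permutations of `[n]`: bijections `σ` of `[±n]` with `σ(-i) = -σ(i)`. -/
abbrev SignedPerm (n : ℕ) : Type :=
  {σ : Equiv.Perm {k : ℤ // k ∈ signedRange n} //
    ∀ i j : {k : ℤ // k ∈ signedRange n}, (j : ℤ) = -(i : ℤ) → (σ j : ℤ) = -(σ i : ℤ)}

/-- The entry `σ_i = σ(i)` for `i ∈ [±n]`; the value is `0` for all other `i`. -/
noncomputable def entry {n : ℕ} (σ : SignedPerm n) (i : ℤ) : ℤ :=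
  if h : i ∈ signedRange n then (σ.1 ⟨i, h⟩ : ℤ) else 0

/-- The position `i ∈ [n]` with `|σ_i| = j`, for `j ∈ [n]`; it is `|σ⁻¹(j)|`. -/
noncomputable def pos {n : ℕ} (σ : SignedPerm n) (j : ℕ) : ℕ :=
  if h : (j : ℤ) ∈ signedRange n then (σ.1.symm ⟨j, h⟩ : ℤ).natAbs else 0

/-- Snakes: `σ_1 > σ_2 < σ_3 > ⋯ σ_n`. -/
abbrev IsSnake {n : ℕ} (σ : SignedPerm n) : Prop :=
  ∀ i ∈ Finset.Ico 1 n, (Odd i → entry σ ((i : ℤ) + 1) < entry σ (i : ℤ)) ∧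
    (Even i → entry σ (i : ℤ) < entry σ ((i : ℤ) + 1))

/-- The set of snakes of size `n`. -/
noncomputable def snakes (n : ℕ) : Finset (SignedPerm n) :=
  Finset.univ.filter fun σ => IsSnake σ

/-- The snakes with `σ_1 > 0` (for `n = 0` the empty snake). -/
noncomputable def snakes0 (n : ℕ) : Finset (SignedPerm n) :=
  (snakes n).filter fun σ => 1 ≤ n → 0 < entry σ 1

/-- The snakes with `σ_1 > 0` and `(-1)^n σ_n < 0`. -/
noncomputable def snakes00 (n : ℕ) : Finset (SignedPerm n) :=
  (snakes0 n).filter fun σ => (-1) ^ n * entry σ n < 0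

/-- The word `σ_0 σ_1 ⋯ σ_n σ_{n+1}` with `σ_0 = 0` and `σ_{n+1} = (-1)^n (n+1)`. -/
noncomputable def word0 {n : ℕ} (σ : SignedPerm n) (i : ℕ) : ℤ :=
  if i = n + 1 then (-1) ^ n * (n + 1) else entry σ i

/-- The word `σ_0 σ_1 ⋯ σ_n σ_{n+1}` with `σ_0 = σ_{n+1} = 0`. -/
noncomputable def word00 {n : ℕ} (σ : SignedPerm n) (i : ℕ) : ℤ :=
  if i = n + 1 then 0 else entry σ i

/-! ### Statistics of words

Below `w` stands for a word `w 0, w 1, …, w (n+1)` of integers (one of `word0 σ`, `word00 σ`),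
and `absWord w` for the word `|σ|`. -/

/-- The word of absolute values. -/
def absWord (w : ℕ → ℤ) (i : ℕ) : ℕ := (w i).natAbs

/-- The number of sign changes `cs(σ) = #{i : σ_i σ_{i+1} < 0, 0 ≤ i ≤ n}`. -/
def cs (n : ℕ) (w : ℕ → ℤ) : ℕ :=
  #{i ∈ Finset.range (n + 1) | w i * w (i + 1) < 0}

/-- The position `i` holds a valley, `π_{i-1} > π_i < π_{i+1}`. -/
abbrev IsValley (p : ℕ → ℕ) (i : ℕ) : Prop := p i < p (i - 1) ∧ p i < p (i + 1)

/-- The position `i` holds a double ascent, `π_{i-1} < π_i < π_{i+1}`. -/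
abbrev IsDoubleAscent (p : ℕ → ℕ) (i : ℕ) : Prop := p (i - 1) < p i ∧ p i < p (i + 1)

/-- The position `i` holds a double descent, `π_{i-1} > π_i > π_{i+1}`. -/
abbrev IsDoubleDescent (p : ℕ → ℕ) (i : ℕ) : Prop := p i < p (i - 1) ∧ p (i + 1) < p i

/-- The position `i` holds a peak, `π_{i-1} < π_i > π_{i+1}`. -/
abbrev IsPeak (p : ℕ → ℕ) (i : ℕ) : Prop := p (i - 1) < p i ∧ p (i + 1) < p i

/-- The sign changes on both sides of the position `i`. -/
abbrev SignChanges (w : ℕ → ℤ) (i : ℕ) : Prop := w (i - 1) * w i < 0 ∧ w i * w (i + 1) < 0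

/-- `13-2(π,i) = #{j : 0 ≤ j < i-1, π_j < π_i < π_{j+1}}`, for the entry at position `i`. -/
def pat132 (p : ℕ → ℕ) (i : ℕ) : ℕ :=
  #{j ∈ Finset.range i | j + 1 < i ∧ p j < p i ∧ p i < p (j + 1)}

/-- `2-31(π,i) = #{j : i < j ≤ n, π_j > π_i > π_{j+1}}`, for the entry at position `i`. -/
def pat231At (n : ℕ) (p : ℕ → ℕ) (i : ℕ) : ℕ :=
  #{j ∈ Finset.Ioc i n | p i < p j ∧ p (j + 1) < p i}

/-- `2-31(π) = ∑_{i=1}^n 2-31(π,i)`. -/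
def pat231 (n : ℕ) (p : ℕ → ℕ) : ℕ := ∑ i ∈ Finset.Icc 1 n, pat231At n p i

/-- The positions of the valleys with sign changes. -/
def setX (n : ℕ) (w : ℕ → ℤ) : Finset ℕ :=
  {i ∈ Finset.Icc 1 n | IsValley (absWord w) i ∧ SignChanges w i}

/-- The positions of the double ascents and double descents. -/
def setY (n : ℕ) (w : ℕ → ℤ) : Finset ℕ :=
  {i ∈ Finset.Icc 1 n | IsDoubleAscent (absWord w) i ∨ IsDoubleDescent (absWord w) i}

/-- The positions of the peaks. -/
def setZ (n : ℕ) (w : ℕ → ℤ) : Finset ℕ :=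
  {i ∈ Finset.Icc 1 n | IsPeak (absWord w) i}

/-- The statistic `pat_Q`, computed on the word `w` of length `n`. -/
def patQ (n : ℕ) (w : ℕ → ℤ) : ℤ :=
  (∑ i ∈ setX n w, 2 * ((pat132 (absWord w) i : ℤ) + pat231At n (absWord w) i)) - #(setX n w)
    + ∑ i ∈ setY n w, ((pat132 (absWord w) i : ℤ) + pat231At n (absWord w) i)

/-- The statistic `pat_R`, computed on the word `w` of length `n`. -/
def patR (n : ℕ) (w : ℕ → ℤ) : ℤ :=
  (∑ i ∈ setX n w, 2 * ((pat132 (absWord w) i : ℤ) + pat231At n (absWord w) i - 1))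
    + (∑ i ∈ setY n w, ((pat132 (absWord w) i : ℤ) + pat231At n (absWord w) i))
    + #(setZ n w)

/-- The blocks of `p 0, …, p (n+1)` restricted to `{0,…,k}`, that is, the maximal intervals
`[a, b]` of positions all of whose entries are at most `k`, recorded as pairs `(a, b)`. -/
def blocks (n : ℕ) (p : ℕ → ℕ) (k : ℕ) : Finset (ℕ × ℕ) :=
  {I ∈ Finset.range (n + 2) ×ˢ Finset.range (n + 2) | I.1 ≤ I.2 ∧
    (∀ i ∈ Finset.Icc I.1 I.2, p i ≤ k) ∧
    (I.1 = 0 ∨ k < p (I.1 - 1)) ∧ (I.2 = n + 1 ∨ k < p (I.2 + 1))}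

/-- `α(π,k)`: the number of blocks restricted to `{0,…,k}`. -/
def alpha (n : ℕ) (p : ℕ → ℕ) (k : ℕ) : ℕ := #(blocks n p k)

/-- `β(π,k)`, where `i` is the position of `k = p i`: the number of blocks restricted to `{0,…,k}`
on the right of the block containing `k` (these are the blocks that start after position `i`). -/
def beta (n : ℕ) (p : ℕ → ℕ) (i : ℕ) : ℕ := #{I ∈ blocks n p (p i) | i < I.1}

/-! ### Weighted bicolored Motzkin paths -/

/-- The four kinds of steps: up, straight level, wavy level, down. -/
inductive StepKind : Type
  | U
  | L
  | W
  | D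

/-- A step together with its weight, the monomial `t ^ tExp * q ^ qExp`. -/
structure WStep : Type where
  kind : StepKind
  tExp : ℤ
  qExp : ℤ

/-- The change of height along a step. -/
def StepKind.rise : StepKind → ℤ
  | .U => 1
  | .L => 0
  | .W => 0
  | .D => -1

/-- The height of the `j`-th step: the `y`-coordinate of its starting point. -/
def height {n : ℕ} (z : Fin n → WStep) (j : Fin n) : ℤ := ∑ i ∈ Finset.Iio j, (z i).kind.rise

/-- The steps form a bicolored Motzkin path: from `(0,0)` to `(n,0)`, never below the `x`-axis. -/
def IsMotzkin {n : ℕ} (z : Fin n → WStep) : Prop :=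
  (∀ j, 0 ≤ height z j) ∧ ∑ j, (z j).kind.rise = 0

/-- The exponent of `t` in the weight of a path (the product of the weights of its steps). -/
def weightT {n : ℕ} (z : Fin n → WStep) : ℤ := ∑ j, (z j).tExp

/-- The exponent of `q` in the weight of a path (the product of the weights of its steps). -/
def weightQ {n : ℕ} (z : Fin n → WStep) : ℤ := ∑ j, (z j).qExp

/-- The steps admitted at height `h` in the paths for `Q_n`; at height `0` no wavy step is. -/
def AdmissibleQ (h : ℤ) (s : WStep) : Prop :=
  match s.kind with
  | .U => (s.tExp = 0 ∧ 0 ≤ s.qExp ∧ s.qExp ≤ h) ∨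
      (s.tExp = 2 ∧ 2 * h + 1 ≤ s.qExp ∧ s.qExp ≤ 3 * h + 1)
  | .L => s.tExp = 1 ∧ h ≤ s.qExp ∧ s.qExp ≤ 2 * h
  | .W => 1 ≤ h ∧ s.tExp = 1 ∧ h ≤ s.qExp ∧ s.qExp ≤ 2 * h - 1
  | .D => 1 ≤ h ∧ s.tExp = 0 ∧ 0 ≤ s.qExp ∧ s.qExp ≤ h - 1

/-- The steps admitted at height `h` in the paths for `R_n`. -/
def AdmissibleR (h : ℤ) (s : WStep) : Prop :=
  match s.kind with
  | .U => (s.tExp = 0 ∧ 0 ≤ s.qExp ∧ s.qExp ≤ h) ∨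
      (s.tExp = 2 ∧ 2 * h + 2 ≤ s.qExp ∧ s.qExp ≤ 3 * h + 2)
  | .L => s.tExp = 1 ∧ h + 1 ≤ s.qExp ∧ s.qExp ≤ 2 * h + 1
  | .W => s.tExp = 1 ∧ h ≤ s.qExp ∧ s.qExp ≤ 2 * h
  | .D => 1 ≤ h ∧ s.tExp = 0 ∧ 0 ≤ s.qExp ∧ s.qExp ≤ h

/-- The set `𝒯*_n` of weighted bicolored Motzkin paths of length `n`. -/
def pathsQ (n : ℕ) : Set (Fin n → WStep) :=
  {z | IsMotzkin z ∧ ∀ j, AdmissibleQ (height z j) (z j)}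

/-- The set `𝒯_n` of weighted bicolored Motzkin paths of length `n`. -/
def pathsR (n : ℕ) : Set (Fin n → WStep) :=
  {z | IsMotzkin z ∧ ∀ j, AdmissibleR (height z j) (z j)}

/-! ### The maps `Λ_1` and `Λ_2` -/

/-- The step of `Λ_1` given by the entry at position `i` of the word `w` of length `n`. -/
def stepQ (n : ℕ) (w : ℕ → ℤ) (i : ℕ) : WStep :=
  let p := absWord w
  let a : ℤ := alpha n p (p i)
  let b : ℤ := beta n p i
  if IsValley p i then
    if SignChanges w i then ⟨.U, 2, b + 2 * a - 3⟩ else ⟨.U, 0, b⟩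
  else if IsDoubleAscent p i then ⟨.L, 1, b + a - 1⟩
  else if IsDoubleDescent p i then ⟨.W, 1, b + a - 1⟩
  else ⟨.D, 0, b⟩

/-- The step of `Λ_2` given by the entry at position `i` of the word `w` of length `n`. -/
def stepR (n : ℕ) (w : ℕ → ℤ) (i : ℕ) : WStep :=
  let p := absWord w
  let a : ℤ := alpha n p (p i)
  let b : ℤ := beta n p i
  if IsValley p i then
    if SignChanges w i then ⟨.U, 2, b + 2 * a - 5⟩ else ⟨.U, 0, b - 1⟩
  else if IsDoubleAscent p i then ⟨.L, 1, b + a - 2⟩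
  else if IsDoubleDescent p i then ⟨.W, 1, b + a - 2⟩
  else ⟨.D, 0, b⟩

/-- `Λ_1(σ) = z_1 ⋯ z_n`, where `z_j` is given by the entry `±j` of `σ` (indices shifted by one). -/
noncomputable def lambda1 {n : ℕ} (σ : SignedPerm n) (j : Fin n) : WStep :=
  stepQ n (word0 σ) (pos σ (j + 1))

/-- `Λ_2(σ) = z_1 ⋯ z_n`, where `z_j` is given by the entry `±j` of `σ ∈ B_{n+1}` (indices shifted
by one); the entry `±(n+1)` gives no step. -/
noncomputable def lambda2 {n : ℕ} (σ : SignedPerm (n + 1)) (j : Fin n) : WStep :=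
  stepR (n + 1) (word00 σ) (pos σ (j + 1))

end SnakeEuler

namespace SnakeEuler

/-! ### Runs of small letters in a word -/

/-! The alternating signs `tau w i = (-1)^(i+1) * w i` turn the snake inequalities, the condition on
σ₁ and, for the second family, the one on σₙ into a single rule: adjacent letters have positive sum.
In other words, of two adjacent letters the one with larger absolute value is positive. So the sign
of a letter is free only at a valley of |σ|, and there a positive letter means that σ changes sign
on both sides.

Now reveal the letters by increasing absolute value. Those of absolute value at most k form the
blocks `runs k W`. Passing to k + 1 inserts ±(k+1) as a new block (valley), at the right or left end
of a block (double ascent, double descent), or between two blocks that it joins (peak). The weight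
of the step records the sign of a valley and the number of blocks on the right. Hence the old blocks
and the step determine the new blocks (`IsStep.forward`), and the new blocks determine the old ones
and the step, since only one letter has absolute value k + 1 (`IsStep.backward`). With e = 0 for Q
and e = 1 for R, the height of the path is the number of blocks minus 1 + e: the initial 0, and for
e = 1 also the final 0, holds a block at an end of the word. The ranges in `Admissible` are exactly
the available places of insertion (`IsStep.admissible`, `IsConfig.exists_isStep`). From this
`Encodes.injective` and `exists_encodes` give both bijections.

For the weights, the blocks to the left and to the right of the one containing the new letter are
counted by 13-2 and 2-31 (`IsFactorization.localData`), so α = s_i + 1 and β = 2-31(π,i). The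
exponent of t arises by charging each sign change to the smaller of its two letters
(`IsSnakeWord.sum_tExp`).

For the polynomials, D^h composed with D + UDU or D + DUU is a combination of D^(h+1), D^h and
D^(h-1) whose coefficients are, up to q-factorials, the generating polynomials of the steps at
height h (`iterate_qDeriv_stepOp`). Hence D^h of the n-th iterate is [h]! times the generating
polynomial of the paths from height h (`iterate_qDeriv_iterate_stepOp`), and h = 0 gives Q_n and
R_n. -/

/-- The maximal runs of letters of absolute value at most `k` in the word `W`. -/
def runs (k : ℕ) : List ℤ → List (List ℤ)
  | [] => []
  | x :: W =>
    if x.natAbs ≤ k then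
      if ∃ y ∈ W.head?, y.natAbs ≤ k then
        -- The next letter is small, so `runs k W` begins with its run and the default `[]` is never
        -- used.
        (x :: (runs k W).headD []) :: (runs k W).tail
      else [x] :: runs k W
    else runs k W

theorem runs_cons_big {k : ℕ} {x : ℤ} (h : k < x.natAbs) (W : List ℤ) :
    runs k (x :: W) = runs k W := by
  rw [runs, if_neg (by omega)]

theorem runs_ne_nil {k : ℕ} {W : List ℤ} {y : ℤ} (hy : y ∈ W) (h : y.natAbs ≤ k) :
    runs k W ≠ [] := by
  induction W with
  | nil => simp at hy
  | cons x W ih =>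
    rw [runs]
    split_ifs with h1 h2
    · simp
    · simp
    · rcases List.mem_cons.1 hy with rfl | hy
      · exact absurd h h1
      · exact ih hy

/-- A letter above the threshold lies in no run and separates the runs on its two sides. -/
theorem runs_append_cons {k : ℕ} {x : ℤ} (h : k < x.natAbs) (U V : List ℤ) :
    runs k (U ++ x :: V) = runs k U ++ runs k V := by
  induction U with
  | nil => simp [runs_cons_big h, runs]
  | cons y U ih =>
    simp only [List.cons_append, runs, ih]
    by_cases hy : y.natAbs ≤ k
    · simp only [hy, if_true]
      rcases U with _ | ⟨z, U⟩
      · simp [runs, show ¬ x.natAbs ≤ k by omega]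
      · by_cases hz : z.natAbs ≤ k
        · have hne : runs k (z :: U) ≠ [] := runs_ne_nil (List.mem_cons_self) hz
          obtain ⟨b, B, hb⟩ := List.exists_cons_of_ne_nil hne
          simp [hz, hb]
        · simp [hz]
    · simp [hy]

theorem runs_of_forall_big {k : ℕ} {M : List ℤ} (h : ∀ x ∈ M, k < x.natAbs) :
    runs k M = [] := by
  induction M with
  | nil => rfl
  | cons x M ih =>
    rw [runs_cons_big (h x (by simp)), ih fun y hy => h y (by simp [hy])]

theorem runs_of_forall_small {k : ℕ} {b : List ℤ} (hb : b ≠ []) (h : ∀ x ∈ b, x.natAbs ≤ k) :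
    runs k b = [b] := by
  induction b with
  | nil => exact absurd rfl hb
  | cons x b ih =>
    have hx := h x (by simp)
    rcases b with _ | ⟨y, b⟩
    · simp [runs, hx]
    · have hy := h y (by simp)
      rw [runs, ih (by simp) fun z hz => h z (by simp [hz])]
      simp [hx, hy]

/-- Both thresholds select the same letters. This is applied to the two sides of a factorization
around ±(k+1). -/
theorem runs_congr {k : ℕ} {W : List ℤ} (h : ∀ x ∈ W, x.natAbs ≠ k + 1) :
    runs (k + 1) W = runs k W := by
  induction W with
  | nil => rfl
  | cons x W ih =>
    have hx := h x (by simp)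
    have e : x.natAbs ≤ k + 1 ↔ x.natAbs ≤ k := by omega
    have e' : (∃ y ∈ W.head?, y.natAbs ≤ k + 1) ↔ ∃ y ∈ W.head?, y.natAbs ≤ k := by
      refine exists_congr fun y => and_congr_right fun hy => ?_
      have := h y (List.mem_cons_of_mem _ (List.mem_of_head? hy))
      omega
    simp only [runs, ih fun y hy => h y (List.mem_cons_of_mem _ hy), e, e']

/-- The list of blocks with the single block `l`, or without any if `l` is empty. -/
def optBlock (l : List ℤ) : List (List ℤ) := if l = [] then [] else [l]

theorem flatten_optBlock (l : List ℤ) : (optBlock l).flatten = l := by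
  unfold optBlock; split_ifs with h <;> simp [h]

theorem optBlock_of_ne {l : List ℤ} (h : l ≠ []) : optBlock l = [l] := if_neg h

theorem runs_of_small {k : ℕ} {b : List ℤ} (h : ∀ x ∈ b, x.natAbs ≤ k) :
    runs k b = optBlock b := by
  by_cases hb : b = []
  · subst hb; rfl
  · rw [runs_of_forall_small hb h, optBlock_of_ne hb]

/-- A factor of small letters that cannot be extended to the right or to the left. -/
theorem runs_append_block {k : ℕ} {U b V : List ℤ} (hb : ∀ x ∈ b, x.natAbs ≤ k)
    (hU : ∀ y ∈ U.getLast?, k < y.natAbs) (hV : ∀ y ∈ V.head?, k < y.natAbs) :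
    runs k (U ++ b ++ V) = runs k U ++ optBlock b ++ runs k V := by
  have h1 : runs k (b ++ V) = optBlock b ++ runs k V := by
    rcases V with _ | ⟨y, V⟩
    · simp [runs_of_small hb, runs]
    · have hy : k < y.natAbs := hV y (by simp)
      rw [runs_append_cons hy, runs_cons_big hy, runs_of_small hb]
  rcases List.eq_nil_or_concat U with rfl | ⟨U, y, rfl⟩
  · simpa [runs] using h1
  · have hy : k < y.natAbs := hU y (by simp)
    have : runs k (U ++ [y]) = runs k U := by
      rw [runs_append_cons hy]; simp [runs]
    rw [List.concat_eq_append, this, List.append_assoc, List.append_assoc, List.singleton_append,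
      runs_append_cons hy, h1, List.append_assoc]

/-! ### Insertion of a letter into a list of blocks -/

/-- The kind of the step when a new letter is put between the factors `l` and `r`. -/
def kindOf (l r : List ℤ) : StepKind :=
  if l = [] then if r = [] then .U else .W else if r = [] then .L else .D

/-- The weighted step of a given kind, where `x` is the new letter, `a` the number of blocks and
`b` the number of blocks on the right of `x`. -/
def wstep (e : ℤ) (s : StepKind) (x a b : ℤ) : WStep :=
  match s with
  | .U => if 0 < x then ⟨.U, 2, b + 2 * a - 3 - 2 * e⟩ else ⟨.U, 0, b - e⟩
  | .L => ⟨.L, 1, b + a - 1 - e⟩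
  | .W => ⟨.W, 1, b + a - 1 - e⟩
  | .D => ⟨.D, 0, b⟩

theorem wstep_kind (e : ℤ) (s : StepKind) (x a b : ℤ) : (wstep e s x a b).kind = s := by
  cases s <;> simp only [wstep]; split_ifs <;> rfl

/-- The list of blocks `c'` is obtained from `c` by insertion of a letter `±(k+1)`, and `s` is the
corresponding weighted step. -/
structure IsStep (e k : ℕ) (c c' : List (List ℤ)) (s : WStep) (A : List (List ℤ)) (l : List ℤ)
    (x : ℤ) (r : List ℤ) (B : List (List ℤ)) : Prop where
  before : c = A ++ optBlock l ++ optBlock r ++ B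
  after : c' = A ++ (l ++ x :: r) :: B
  abs : x.natAbs = k + 1
  fresh : ∀ y ∈ A.flatten ++ l ++ r ++ B.flatten, y.natAbs ≠ k + 1
  sign : 0 < x ∨ l = [] ∧ r = []
  left : l = [] → A ≠ []
  right : e = 1 → r = [] → B ≠ []
  step : s = wstep e (kindOf l r) x c'.length B.length

/-- The number of blocks grows by one minus the number of nonempty factors among `l` and `r`, which
is the rise of the kind. -/
theorem IsStep.length_add {e k : ℕ} {c c' : List (List ℤ)} {s : WStep} {A l x r B}
    (h : IsStep e k c c' s A l x r B) : (c'.length : ℤ) = c.length + s.kind.rise := by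
  rw [h.step, wstep_kind, h.before, h.after]
  unfold kindOf optBlock
  split_ifs <;> simp [StepKind.rise] <;> ring

/-- The kind fixes the new number of blocks. In the case `U` the exponent of t gives the sign of the
letter, which is positive otherwise. The exponent of q then yields the number of blocks on the
right, and this locates the insertion, counted from the right end of the list. -/
theorem IsStep.forward {e k : ℕ} {c c₁ c₂ : List (List ℤ)} {s : WStep} {A₁ l₁ x₁ r₁ B₁}
    {A₂ l₂ x₂ r₂ B₂} (h₁ : IsStep e k c c₁ s A₁ l₁ x₁ r₁ B₁)
    (h₂ : IsStep e k c c₂ s A₂ l₂ x₂ r₂ B₂) : c₁ = c₂ := by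
  have hlen : (c₁.length : ℤ) = c₂.length := by rw [h₁.length_add, h₂.length_add]
  have hk : kindOf l₁ r₁ = kindOf l₂ r₂ := by
    have := congrArg WStep.kind (h₁.step.symm.trans h₂.step)
    simpa [wstep_kind] using this
  have hs := h₁.step.symm.trans h₂.step
  have ha₁ := h₁.abs
  have ha₂ := h₂.abs
  have hb := h₁.before.symm.trans h₂.before
  have s₁ := h₁.sign
  have s₂ := h₂.sign
  rw [h₁.after, h₂.after]
  rw [hk, hlen] at hs
  have hx : x₁ = x₂ ∧ B₁.length = B₂.length := by
    unfold kindOf at hk hs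
    split_ifs at hk hs <;> simp only [wstep] at hs
    · split_ifs at hs <;> simp at hs <;> omega
    all_goals
      simp at hs
      simp_all
      omega
  obtain ⟨rfl, hB⟩ := hx
  have hB' : B₁ = B₂ := List.append_inj_right' hb hB
  subst hB'
  have hb' := List.append_cancel_right hb
  unfold kindOf at hk
  by_cases l1 : l₁ = [] <;> by_cases r1 : r₁ = [] <;> by_cases l2 : l₂ = [] <;>
    by_cases r2 : r₂ = [] <;> simp [l1, r1, l2, r2] at hk <;>
    simp [optBlock, l1, r1, l2, r2] at hb'
  · simp [*]
  · simp [hb', l1, l2]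
  · simp [hb', r1, r2]
  · obtain ⟨rfl, h⟩ := List.append_inj' hb' rfl
    simp_all

/-- Both decompositions cut the list at its first element satisfying `p`. -/
theorem eq_of_append_cons_eq {α : Type*} (p : α → Prop) {s t s' t' : List α} {a a' : α}
    (h : s ++ a :: t = s' ++ a' :: t') (ha : p a) (ha' : p a') (hs : ∀ x ∈ s, ¬ p x)
    (hs' : ∀ x ∈ s', ¬ p x) : s = s' ∧ a = a' ∧ t = t' := by
  induction s generalizing s' with
  | nil =>
    rcases s' with _ | ⟨b, s'⟩
    · simpa using h
    · simp at h
      exact absurd (h.1 ▸ ha) (hs' b (by simp))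
  | cons b s ih =>
    rcases s' with _ | ⟨b', s'⟩
    · simp at h
      exact absurd (h.1 ▸ ha') (hs b (by simp))
    · simp only [List.cons_append, List.cons.injEq] at h
      obtain ⟨h1, h2⟩ := ih h.2 (fun x hx => hs x (by simp [hx])) fun x hx => hs' x (by simp [hx])
      exact ⟨by rw [h.1, h1], h2⟩

/-- Only one block of `c'` holds a letter of absolute value k + 1, and only once; cutting there
recovers all data of the insertion. -/
theorem IsStep.backward {e k : ℕ} {c₁ c₂ c' : List (List ℤ)} {s₁ s₂ : WStep} {A₁ l₁ x₁ r₁ B₁}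
    {A₂ l₂ x₂ r₂ B₂} (h₁ : IsStep e k c₁ c' s₁ A₁ l₁ x₁ r₁ B₁)
    (h₂ : IsStep e k c₂ c' s₂ A₂ l₂ x₂ r₂ B₂) : c₁ = c₂ ∧ s₁ = s₂ := by
  have f₁ := h₁.fresh
  have f₂ := h₂.fresh
  obtain ⟨hA, hb, hB⟩ := eq_of_append_cons_eq (fun b : List ℤ => ∃ y ∈ b, y.natAbs = k + 1)
    (h₁.after.symm.trans h₂.after) ⟨x₁, by simp, h₁.abs⟩ ⟨x₂, by simp, h₂.abs⟩
    (fun b hb ⟨y, hy, h⟩ => f₁ y (by simp; left; exact ⟨b, hb, hy⟩) h)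
    (fun b hb ⟨y, hy, h⟩ => f₂ y (by simp; left; exact ⟨b, hb, hy⟩) h)
  obtain ⟨hl, hx, hr⟩ := eq_of_append_cons_eq (fun y : ℤ => y.natAbs = k + 1) hb h₁.abs h₂.abs
    (fun y hy => f₁ y (by simp [hy])) (fun y hy => f₂ y (by simp [hy]))
  subst hA hB hl hx hr
  exact ⟨h₁.before.trans h₂.before.symm, h₁.step.trans h₂.step.symm⟩

end SnakeEuler

namespace SnakeEuler

/-! ### Admissible steps and configurations of blocks -/

/-- The steps admitted at height `h`: `e = 0` for `Q_n`, `e = 1` for `R_n`. -/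
def Admissible (e : ℕ) (h : ℤ) (s : WStep) : Prop :=
  match s.kind with
  | .U => (s.tExp = 0 ∧ 0 ≤ s.qExp ∧ s.qExp ≤ h) ∨
      (s.tExp = 2 ∧ 2 * h + 1 + e ≤ s.qExp ∧ s.qExp ≤ 3 * h + 1 + e)
  | .L => s.tExp = 1 ∧ h + e ≤ s.qExp ∧ s.qExp ≤ 2 * h + e
  | .W => s.tExp = 1 ∧ h ≤ s.qExp ∧ s.qExp ≤ 2 * h - 1 + e
  | .D => 1 ≤ h ∧ s.tExp = 0 ∧ 0 ≤ s.qExp ∧ s.qExp ≤ h - 1 + e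

theorem admissibleQ_iff (h : ℤ) (s : WStep) : AdmissibleQ h s ↔ Admissible 0 h s := by
  obtain ⟨k, t, q⟩ := s
  cases k <;> simp [AdmissibleQ, Admissible]
  omega

theorem admissibleR_iff (h : ℤ) (s : WStep) : AdmissibleR h s ↔ Admissible 1 h s := by
  obtain ⟨k, t, q⟩ := s
  cases k <;> simp [AdmissibleR, Admissible]
  omega

/-- If `c` has h + 1 + e blocks, the number of blocks right of the new letter runs from e to h + e
for `U` and `L`, and from 0 to h - 1 + e for `W` and `D`; `left` and `right` forbid the places
outside the end zeros. For e = 1 the bound `hc` excludes joining the last two blocks, which is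
reserved for the largest letter. -/
theorem IsStep.admissible {e k : ℕ} (he : e ≤ 1) {c c' : List (List ℤ)} {s : WStep} {A l x r B}
    (h : IsStep e k c c' s A l x r B) (hc : 1 + e ≤ c'.length) :
    Admissible e ((c.length : ℤ) - 1 - e) s := by
  have h1 : l = [] → 1 ≤ A.length := fun h0 => List.length_pos_iff.2 (h.left h0)
  have h2 : e = 1 → r = [] → 1 ≤ B.length := fun h0 h0' => List.length_pos_iff.2 (h.right h0 h0')
  have h3 := h.sign
  have h4 := h.after
  subst h4
  rw [h.step, h.before]
  unfold kindOf optBlock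
  simp only [List.length_append, List.length_cons] at hc ⊢
  by_cases hl : l = [] <;> by_cases hr : r = [] <;>
    simp only [hl, hr, if_true, if_false, wstep, Admissible, List.length_nil, List.length_cons,
      forall_true_left, IsEmpty.forall_iff] at *
  · split_ifs <;> simp <;> omega
  all_goals
    simp
    omega

/-- The list `c` of blocks made of the letters `±1, …, ±k` and of one (`e = 0`) or two (`e = 1`)
letters `0` at the ends. -/
structure IsConfig (e k : ℕ) (c : List (List ℤ)) : Prop where
  ne_nil : ∀ b ∈ c, b ≠ []
  chain : ∀ b ∈ c, b.IsChain fun x y => 0 < x + y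
  flatten : ∃ M : List ℤ, c.flatten = 0 :: M ++ List.replicate e 0 ∧
    (M.map Int.natAbs).Perm (List.range' 1 k)

theorem IsConfig.abs_le {e k : ℕ} {c : List (List ℤ)} (h : IsConfig e k c) {y : ℤ}
    (hy : y ∈ c.flatten) : y.natAbs ≤ k := by
  obtain ⟨M, hM, hp⟩ := h.flatten
  rw [hM] at hy
  simp only [List.cons_append, List.mem_cons, List.mem_append, List.mem_replicate] at hy
  rcases hy with rfl | hy | ⟨-, rfl⟩
  · simp
  · have : y.natAbs ∈ List.range' 1 k := hp.mem_iff.1 (List.mem_map_of_mem hy)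
    simp at this; omega
  · simp

theorem flatten_ne_nil {A : List (List ℤ)} (hA : A ≠ []) (h : ∀ b ∈ A, b ≠ []) :
    A.flatten ≠ [] := by
  obtain ⟨b, A, rfl⟩ := List.exists_cons_of_ne_nil hA
  simp [h b (by simp)]

/-- Insertion of a letter `x = ±(k+1)` in a list of blocks gives a list of blocks. -/
theorem IsConfig.insert {e k : ℕ} (he : e ≤ 1) {c : List (List ℤ)} (hc : IsConfig e k c)
    {A l r B} {x : ℤ} (hb : c = A ++ optBlock l ++ optBlock r ++ B) (hx : x.natAbs = k + 1)
    (hs : 0 < x ∨ l = [] ∧ r = []) (hl : l = [] → A ≠ []) (hr : e = 1 → r = [] → B ≠ []) :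
    IsConfig e (k + 1) (A ++ (l ++ x :: r) :: B) := by
  obtain ⟨M, hM, hp⟩ := hc.flatten
  have hne := hc.ne_nil
  have hle : ∀ y ∈ c.flatten, y.natAbs ≤ k := fun y hy => hc.abs_le hy
  have hch := hc.chain
  have hflat : c.flatten = (A.flatten ++ l) ++ (r ++ B.flatten) := by
    rw [hb]; simp [flatten_optBlock]
  -- Something stands to the left of the new letter, and for e = 1 also to its right. So the end
  -- zeros stay at the ends and the letter goes inside `M`.
  have hl' : A.flatten ++ l ≠ [] := by
    by_cases h : l = []
    · simpa [h] using flatten_ne_nil (hl h) fun b hb' => hne b (by rw [hb]; simp [hb'])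
    · simp [h]
  have hr' : e = 1 → r ++ B.flatten ≠ [] := by
    intro h1
    by_cases h : r = []
    · simpa [h] using flatten_ne_nil (hr h1 h) fun b hb' => hne b (by rw [hb]; simp [hb'])
    · simp [h]
  refine ⟨?_, ?_, ?_⟩
  · intro b hb'
    simp only [List.mem_append, List.mem_cons] at hb'
    rcases hb' with h | rfl | h
    · exact hne b (by rw [hb]; simp [h])
    · simp
    · exact hne b (by rw [hb]; simp [h])
  · intro b hb'
    simp only [List.mem_append, List.mem_cons] at hb'
    rcases hb' with h | rfl | h
    · exact hch b (by rw [hb]; simp [h])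
    · have hcl : l.IsChain fun x y => 0 < x + y := by
        by_cases h : l = []
        · simp [h]
        · exact hch l (by rw [hb]; simp [optBlock, h])
      have hcr : r.IsChain fun x y => 0 < x + y := by
        by_cases h : r = []
        · simp [h]
        · exact hch r (by rw [hb]; simp [optBlock, h])
      have hll : ∀ y ∈ l, y.natAbs ≤ k := fun y hy => hle y (by rw [hflat]; simp [hy])
      have hrr : ∀ y ∈ r, y.natAbs ≤ k := fun y hy => hle y (by rw [hflat]; simp [hy])
      -- The neighbours in the block have absolute value at most k, so a positive new letter
      -- outweighs them; a negative one has no neighbours in its block.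
      rw [List.isChain_append]
      refine ⟨hcl, ?_, ?_⟩
      · rw [List.isChain_cons]
        refine ⟨fun y hy => ?_, hcr⟩
        have hy' := List.mem_of_head? hy
        have := hrr y hy'
        rcases hs with hs | ⟨-, rfl⟩
        · omega
        · simp at hy'
      · intro y hy z hz
        simp only [List.head?_cons, Option.mem_def, Option.some.injEq] at hz
        subst hz
        have hy' := List.mem_of_getLast? hy
        have := hll y hy'
        rcases hs with hs | ⟨rfl, -⟩
        · omega
        · simp at hy'
    · exact hch b (by rw [hb]; simp [h])
  · obtain ⟨M₁, M₂, h1, h2, h3⟩ : ∃ M₁ M₂, A.flatten ++ l = 0 :: M₁ ∧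
        r ++ B.flatten = M₂ ++ List.replicate e 0 ∧ M = M₁ ++ M₂ := by
      rw [hflat] at hM
      obtain ⟨y, M₁, h1⟩ := List.exists_cons_of_ne_nil hl'
      rw [h1] at hM
      simp only [List.cons_append, List.cons.injEq] at hM
      obtain ⟨rfl, hM⟩ := hM
      refine ⟨M₁, ?_⟩
      obtain rfl | rfl : e = 0 ∨ e = 1 := by omega
      · exact ⟨r ++ B.flatten, h1, by simp, by simpa using hM.symm⟩
      · obtain ⟨M₂, z, h2⟩ := List.eq_nil_or_concat (r ++ B.flatten) |>.resolve_left (hr' rfl)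
        rw [h2, List.concat_eq_append, ← List.append_assoc] at hM
        obtain ⟨h3, h4⟩ := List.append_inj' hM (by simp)
        simp only [List.replicate_one, List.cons.injEq, and_true] at h4
        exact ⟨M₂, h1, by rw [h2, h4]; simp, h3.symm⟩
    refine ⟨M₁ ++ x :: M₂, ?_, ?_⟩
    · rw [List.flatten_append, List.flatten_cons, ← List.append_assoc, ← List.append_assoc, h1,
        List.append_assoc, List.cons_append, List.cons_append, h2]
      simp
    · rw [List.range'_concat, List.map_append, List.map_cons, hx]
      refine List.perm_middle.trans ?_
      rw [← List.map_append, ← h3, show 1 + 1 * k = k + 1 by ring]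
      exact (hp.cons _).trans (List.perm_append_singleton _ _).symm

theorem IsStep.isConfig {e k : ℕ} (he : e ≤ 1) {c c' : List (List ℤ)} {s : WStep} {A l x r B}
    (h : IsStep e k c c' s A l x r B) (hc : IsConfig e k c) : IsConfig e (k + 1) c' :=
  h.after ▸ hc.insert he h.before h.abs h.sign h.left h.right

theorem exists_append_of_length {α : Type*} (c : List α) {b : ℕ} (h : b ≤ c.length) :
    ∃ A B, c = A ++ B ∧ B.length = b :=
  ⟨c.take (c.length - b), c.drop (c.length - b), by simp, by simp; omega⟩

/-- Every admissible step can be performed. -/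
theorem IsConfig.exists_isStep {e k : ℕ} (he : e ≤ 1) {c : List (List ℤ)} (hc : IsConfig e k c)
    {h : ℕ} (hh : c.length = h + 1 + e) {s : WStep} (hs : Admissible e h s) :
    ∃ c' A l x r B, IsStep e k c c' s A l x r B := by
  have hne := hc.ne_nil
  have fresh : ∀ {A l r B}, c = A ++ optBlock l ++ optBlock r ++ B →
      ∀ y ∈ A.flatten ++ l ++ r ++ B.flatten, y.natAbs ≠ k + 1 := by
    intro A l r B hb y hy
    have := hc.abs_le (y := y) (by
      rw [hb]
      simpa only [List.flatten_append, flatten_optBlock] using hy)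
    omega
  obtain ⟨κ, t, q⟩ := s
  cases κ
  · -- a new block
    have key : ∀ (x : ℤ) (β : ℤ), x.natAbs = k + 1 → e ≤ β → β ≤ h + e →
        wstep e .U x (h + 2 + e) β = ⟨.U, t, q⟩ →
        ∃ c' A l x r B, IsStep e k c c' ⟨.U, t, q⟩ A l x r B := by
      intro x β hx h1 h2 h3
      obtain ⟨b, rfl⟩ := Int.eq_ofNat_of_zero_le (show 0 ≤ β by omega)
      obtain ⟨A, B, rfl, hB⟩ := exists_append_of_length c (b := b) (by omega)
      have hb : A ++ B = A ++ optBlock [] ++ optBlock [] ++ B := by simp [optBlock]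
      rw [List.length_append] at hh
      refine ⟨_, A, [], x, [], B, hb, rfl, hx, fresh hb, Or.inr ⟨rfl, rfl⟩, fun _ => ?_,
        fun _ _ => ?_, ?_⟩
      · exact List.length_pos_iff.1 (by omega)
      · exact List.length_pos_iff.1 (by omega)
      · rw [← h3]
        simp only [kindOf, if_true]
        congr 1
        · simp; omega
        · omega
    simp only [Admissible] at hs
    rcases hs with ⟨rfl, h1, h2⟩ | ⟨rfl, h1, h2⟩
    · refine key (-(k + 1)) (q + e) (by omega) (by omega) (by omega) ?_
      rw [wstep, if_neg (by omega)]
      simp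
    · refine key (k + 1) (q - 2 * h - 1) (by omega) (by omega) (by omega) ?_
      rw [wstep, if_pos (by omega)]
      simp; ring
  · simp only [Admissible] at hs
    obtain ⟨rfl, h1, h2⟩ := hs
    -- A level step keeps h + 1 + e blocks, so its exponent is b + h. The same holds for the wavy
    -- step below.
    obtain ⟨b, hb'⟩ := Int.eq_ofNat_of_zero_le (show 0 ≤ q - h by omega)
    obtain ⟨A, B, rfl, hB⟩ := exists_append_of_length c (b := b) (by omega)
    rw [List.length_append] at hh
    obtain ⟨A, l, rfl⟩ := (List.eq_nil_or_concat A).resolve_left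
      (List.length_pos_iff.1 (by omega))
    simp only [List.concat_eq_append] at *
    have hl : l ≠ [] := hne l (by simp)
    have hb : A ++ [l] ++ B = A ++ optBlock l ++ optBlock [] ++ B := by simp [optBlock, hl]
    simp only [List.length_append, List.length_cons, List.length_nil] at hh
    refine ⟨_, A, l, k + 1, [], B, hb, rfl, by omega, fresh hb, Or.inl (by omega),
      fun h => absurd h hl, fun _ _ => ?_, ?_⟩
    · exact List.length_pos_iff.1 (by omega)
    · simp only [kindOf, hl, if_false, if_true, wstep]
      congr 1
      simp; omega
  · simp only [Admissible] at hs
    obtain ⟨rfl, h1, h2⟩ := hs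
    obtain ⟨b, hb'⟩ := Int.eq_ofNat_of_zero_le (show 0 ≤ q - h by omega)
    obtain ⟨A, B, rfl, hB⟩ := exists_append_of_length c (b := b) (by omega)
    rw [List.length_append] at hh
    obtain ⟨A, r, rfl⟩ := (List.eq_nil_or_concat A).resolve_left
      (List.length_pos_iff.1 (by omega))
    simp only [List.concat_eq_append] at *
    have hr : r ≠ [] := hne r (by simp)
    have hb : A ++ [r] ++ B = A ++ optBlock [] ++ optBlock r ++ B := by simp [optBlock, hr]
    simp only [List.length_append, List.length_cons, List.length_nil] at hh
    refine ⟨_, A, [], k + 1, r, B, hb, rfl, by omega, fresh hb, Or.inl (by omega),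
      fun _ => ?_, fun _ h => absurd h hr, ?_⟩
    · exact List.length_pos_iff.1 (by omega)
    · simp only [kindOf, hr, if_false, if_true, wstep]
      congr 1
      simp; omega
  · simp only [Admissible] at hs
    obtain ⟨h0, rfl, h1, h2⟩ := hs
    obtain ⟨b, rfl⟩ := Int.eq_ofNat_of_zero_le h1
    obtain ⟨A, B, rfl, hB⟩ := exists_append_of_length c (b := b) (by omega)
    rw [List.length_append] at hh
    obtain ⟨A, r, rfl⟩ := (List.eq_nil_or_concat A).resolve_left
      (List.length_pos_iff.1 (by omega))
    simp only [List.concat_eq_append, List.length_append, List.length_cons, List.length_nil] at *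
    obtain ⟨A, l, rfl⟩ := (List.eq_nil_or_concat A).resolve_left
      (List.length_pos_iff.1 (by omega))
    simp only [List.concat_eq_append] at *
    have hr : r ≠ [] := hne r (by simp)
    have hl : l ≠ [] := hne l (by simp)
    have hb : A ++ [l] ++ [r] ++ B = A ++ optBlock l ++ optBlock r ++ B := by
      simp [optBlock, hr, hl]
    refine ⟨_, A, l, k + 1, r, B, hb, rfl, by omega, fresh hb, Or.inl (by omega),
      fun h => absurd h hl, fun _ h => absurd h hr, ?_⟩
    simp only [kindOf, hr, hl, if_false, wstep]
    congr 1
    omega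

end SnakeEuler

namespace SnakeEuler

/-! ### Words and their factorization around a letter -/

/-- The words `0 x₁ ⋯ x_{n+1}`, with `x_{n+1} = n + 1`, if `e = 0`, and `0 x₁ ⋯ x_{n+1} 0` if
`e = 1`, where `x` is a signed permutation and consecutive letters have positive sums. -/
structure IsWord (e n : ℕ) (W : List ℤ) : Prop where
  config : IsConfig e (n + 1) [W]
  last : e = 0 → W.getLast? = some ((n : ℤ) + 1)

/-- The factorization of `W` around its letter `x = ±(k+1)`; here `l`, `r` are the blocks of
letters at most `k` adjacent to `x`. -/
structure IsFactorization (k : ℕ) (W U l : List ℤ) (x : ℤ) (r V : List ℤ) : Prop where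
  eq : W = U ++ (l ++ x :: r) ++ V
  abs : x.natAbs = k + 1
  fresh : ∀ y ∈ U ++ l ++ r ++ V, y.natAbs ≠ k + 1
  small_left : ∀ y ∈ l, y.natAbs ≤ k
  small_right : ∀ y ∈ r, y.natAbs ≤ k
  big_left : ∀ y ∈ U.getLast?, k < y.natAbs
  big_right : ∀ y ∈ V.head?, k < y.natAbs

theorem exists_right_block (k : ℕ) (X : List ℤ) : ∃ r V, X = r ++ V ∧
    (∀ y ∈ r, y.natAbs ≤ k) ∧ ∀ y ∈ V.head?, k < y.natAbs := by
  induction X with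
  | nil => exact ⟨[], [], by simp⟩
  | cons x X ih =>
    by_cases h : x.natAbs ≤ k
    · obtain ⟨r, V, rfl, h1, h2⟩ := ih
      exact ⟨x :: r, V, rfl, by simpa [h] using h1, h2⟩
    · exact ⟨[], x :: X, rfl, by simp, by simpa using h⟩

theorem exists_left_block (k : ℕ) (X : List ℤ) : ∃ U l, X = U ++ l ∧
    (∀ y ∈ l, y.natAbs ≤ k) ∧ ∀ y ∈ U.getLast?, k < y.natAbs := by
  obtain ⟨r, V, h, h1, h2⟩ := exists_right_block k X.reverse
  refine ⟨V.reverse, r.reverse, ?_, by simpa using h1, by simpa using h2⟩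
  rw [← List.reverse_append, ← h, List.reverse_reverse]

/-- The absolute values in `M` are 1, …, n + 1, each once, so ±(k+1) occurs exactly once; `l` and
`r` are the longest factors of small letters adjacent to it. -/
theorem IsWord.exists_factorization {e n : ℕ} {W : List ℤ} (hW : IsWord e n W) {k : ℕ}
    (hk : k ≤ n) : ∃ U l x r V, IsFactorization k W U l x r V := by
  obtain ⟨M, hM, hp⟩ := hW.config.flatten
  simp only [List.flatten_cons, List.flatten_nil, List.append_nil] at hM
  have hmem : k + 1 ∈ M.map Int.natAbs := hp.mem_iff.2 (by simp; omega)
  have hnd : (M.map Int.natAbs).Nodup := hp.nodup_iff.2 List.nodup_range'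
  obtain ⟨x, hxM, hx⟩ := List.mem_map.1 hmem
  obtain ⟨M₁, M₂, rfl⟩ := List.append_of_mem hxM
  obtain ⟨U, l, h1, h2, h3⟩ := exists_left_block k (0 :: M₁)
  obtain ⟨r, V, h4, h5, h6⟩ := exists_right_block k (M₂ ++ List.replicate e 0)
  refine ⟨U, l, x, r, V, ?_, hx, ?_, h2, h5, h3, h6⟩
  · rw [hM, ← List.append_assoc, ← h1, List.append_assoc (0 :: M₁), List.cons_append (a := x), ← h4]
    simp
  · intro y hy
    rw [← h1, List.append_assoc, ← h4] at hy
    simp only [List.map_append, List.map_cons, List.nodup_append, List.nodup_cons, hx,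
      List.mem_cons, List.mem_map] at hnd
    obtain ⟨-, ⟨h7, -⟩, h8⟩ := hnd
    simp only [List.cons_append, List.mem_cons, List.mem_append, List.mem_replicate] at hy
    rcases hy with rfl | hy | hy | ⟨-, rfl⟩
    · simp
    · exact fun h => h8 _ ⟨y, hy, rfl⟩ _ (Or.inl rfl) h
    · exact fun h => h7 ⟨y, hy, h⟩
    · simp

theorem IsWord.eq_zero_cons {e n : ℕ} {W : List ℤ} (hW : IsWord e n W) :
    ∃ M, W = 0 :: M ++ List.replicate e 0 ∧ (M.map Int.natAbs).Perm (List.range' 1 (n + 1)) := by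
  obtain ⟨M, hM, hp⟩ := hW.config.flatten
  exact ⟨M, by simpa using hM, hp⟩

/-- The blocks of `U` and `V` are the same at the thresholds k and k + 1, so only the surroundings
of the letter change. The positive sums force its sign as soon as it has a smaller neighbour. -/
theorem IsFactorization.isStep {e n k : ℕ} {W : List ℤ} (hW : IsWord e n W) {U l x r V}
    (h : IsFactorization k W U l x r V) :
    IsStep e k (runs k W) (runs (k + 1) W)
      (wstep e (kindOf l r) x (runs (k + 1) W).length (runs k V).length)
      (runs k U) l x r (runs k V) := by
  obtain ⟨M, hM, hp⟩ := hW.eq_zero_cons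
  have hx := h.abs
  have hf := h.fresh
  have hU : runs (k + 1) U = runs k U := runs_congr fun y hy => hf y (by simp [hy])
  have hV : runs (k + 1) V = runs k V := runs_congr fun y hy => hf y (by simp [hy])
  have mem_flat : ∀ (X : List ℤ) y, y ∈ (runs k X).flatten → y ∈ X := by
    intro X
    induction X with
    | nil => simp [runs]
    | cons z X ih =>
      intro y hy
      rw [runs] at hy
      split_ifs at hy with h1 h2
      · rcases hX : runs k X with _ | ⟨b, B⟩
        · simp [hX] at hy; simp [hy]
        · rw [hX] at ih hy
          simp at hy ih ⊢
          rcases hy with hy | hy | hy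
          · exact Or.inl hy
          · exact Or.inr (ih y (Or.inl hy))
          · exact Or.inr (ih y (Or.inr hy))
      · simp only [List.flatten_cons, List.cons_append, List.nil_append, List.mem_cons] at hy ⊢
        exact hy.imp_right (ih y)
      · exact List.mem_cons_of_mem _ (ih y hy)
  have hchain : (l ++ x :: r).IsChain fun x y => 0 < x + y := by
    have := hW.config.chain W (by simp)
    rw [h.eq] at this
    exact (List.isChain_append.1 (List.isChain_append.1 this).1).2.1
  refine ⟨?_, ?_, hx, ?_, ?_, ?_, ?_, rfl⟩
  · have hxk : k < x.natAbs := by omega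
    rw [h.eq, show U ++ (l ++ x :: r) ++ V = (U ++ l) ++ x :: (r ++ V) by simp,
      runs_append_cons hxk]
    have h1 := runs_append_block (V := []) h.small_left h.big_left (by simp)
    have h2 := runs_append_block (U := []) h.small_right (by simp) h.big_right
    simp only [List.append_nil, List.nil_append, runs] at h1 h2
    rw [h1, h2, List.append_assoc, List.append_assoc, List.append_assoc]
  · rw [h.eq, runs_append_block, optBlock_of_ne (by simp), hU, hV]
    · simp
    · intro y hy
      simp only [List.mem_append, List.mem_cons] at hy
      rcases hy with hy | rfl | hy
      · have := h.small_left y hy; omega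
      · omega
      · have := h.small_right y hy; omega
    · intro y hy
      have h1 := h.big_left y hy
      have h2 := hf y (by simp [List.mem_of_getLast? hy])
      omega
    · intro y hy
      have h1 := h.big_right y hy
      have h2 := hf y (by simp [List.mem_of_head? hy])
      omega
  · intro y hy
    simp only [List.mem_append] at hy
    rcases hy with ((hy | hy) | hy) | hy
    · exact hf y (by simp [mem_flat _ _ hy])
    · exact hf y (by simp [hy])
    · exact hf y (by simp [hy])
    · exact hf y (by simp [mem_flat _ _ hy])
  · rcases List.eq_nil_or_concat l with rfl | ⟨l', y, rfl⟩
    · rcases r with _ | ⟨y, r⟩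
      · exact Or.inr ⟨rfl, rfl⟩
      · left
        have h1 := h.small_right y (by simp)
        simp only [List.nil_append, List.isChain_cons_cons] at hchain
        omega
    · left
      have h1 := h.small_left y (by simp)
      rw [List.concat_eq_append, List.append_assoc, List.singleton_append] at hchain
      have := List.isChain_append.1 hchain |>.2.1
      simp only [List.isChain_cons_cons] at this
      omega
  -- If `l` is empty, the initial 0 lies in `U` and provides a block there.
  · rintro rfl
    rcases U with _ | ⟨y, U⟩
    · have := h.eq.symm.trans hM
      simp at this
      omega
    · have := h.eq.symm.trans hM
      simp at this
      exact runs_ne_nil (y := y) (by simp) (by rw [this.1]; simp)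
  -- Likewise the final 0 lies in `V`.
  · rintro rfl rfl
    rcases List.eq_nil_or_concat V with rfl | ⟨V', y, rfl⟩
    · have := congrArg List.getLast? (h.eq.symm.trans hM)
      simp [List.getLast?_append, List.getLast?_cons] at this
      omega
    · have := congrArg List.getLast? (h.eq.symm.trans hM)
      simp [List.getLast?_append, List.getLast?_cons] at this
      exact runs_ne_nil (y := y) (by simp) (by rw [this]; simp)

theorem IsWord.abs_le {e n : ℕ} {W : List ℤ} (hW : IsWord e n W) {y : ℤ} (hy : y ∈ W) :
    y.natAbs ≤ n + 1 := hW.config.abs_le (by simpa using hy)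

theorem IsWord.runs_top {e n : ℕ} {W : List ℤ} (hW : IsWord e n W) : runs (n + 1) W = [W] :=
  runs_of_forall_small (hW.config.ne_nil W (by simp)) fun _ hy => hW.abs_le hy

/-- Only the zeros survive at threshold 0, and the nonempty `M` keeps them apart. All words thus
share the same initial configuration. -/
theorem IsWord.runs_zero {e n : ℕ} (he : e ≤ 1) {W : List ℤ} (hW : IsWord e n W) :
    runs 0 W = List.replicate (1 + e) [0] := by
  obtain ⟨M, hM, hp⟩ := hW.eq_zero_cons
  have hbig : ∀ y ∈ M, 0 < y.natAbs := fun y hy => by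
    have : y.natAbs ∈ List.range' 1 (n + 1) := hp.mem_iff.1 (List.mem_map_of_mem hy)
    simp at this; omega
  have hne : M ≠ [] := by
    rintro rfl
    simpa using hp.length_eq
  obtain ⟨y, M, rfl⟩ := List.exists_cons_of_ne_nil hne
  have h1 : runs 0 W = [[0]] ++ runs 0 (M ++ List.replicate e 0) := by
    rw [hM, show 0 :: y :: M ++ List.replicate e 0 = [0] ++ y :: (M ++ List.replicate e 0) by simp,
      runs_append_cons (hbig y (by simp)), runs_of_forall_small] <;> simp
  have hM0 : runs 0 M = [] := runs_of_forall_big fun z hz => hbig z (by simp [hz])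
  have h2 := runs_append_block (k := 0) (U := M) (b := List.replicate e 0) (V := [])
    (by simp +contextual) (fun z hz => hbig z (by simp [List.mem_of_getLast? hz])) (by simp)
  rw [h1]
  rw [List.append_nil] at h2
  rw [h2, hM0]
  obtain rfl | rfl : e = 0 ∨ e = 1 := by omega
  · simp [optBlock, runs]
  · simp [optBlock, runs, List.replicate]

/-- The position of the largest letter. -/
theorem IsWord.eq_append {e n : ℕ} (he : e ≤ 1) {W : List ℤ} (hW : IsWord e n W) :
    ∃ l r, W = l ++ ((n : ℤ) + 1) :: r ∧ l ≠ [] ∧ runs n W = optBlock l ++ optBlock r ∧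
      (e = 0 ↔ r = []) := by
  obtain ⟨U, l, x, r, V, h⟩ := hW.exists_factorization le_rfl
  have hs := h.isStep hW
  have ha := hs.after
  rw [hW.runs_top] at ha
  -- At threshold n + 1 the whole word is one block, so there is no block beside the one of the
  -- largest letter.
  have hA : runs n U = [] := by
    have := congrArg List.length ha
    simp only [List.length_append, List.length_cons, List.length_nil] at this
    exact List.eq_nil_of_length_eq_zero (by omega)
  have hB : runs n V = [] := by
    have := congrArg List.length ha
    simp only [List.length_append, List.length_cons, List.length_nil] at this
    exact List.eq_nil_of_length_eq_zero (by omega)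
  have hb := hs.before
  have hl : l ≠ [] := fun h0 => hs.left h0 hA
  have hx : x = (n : ℤ) + 1 := by
    have := hs.abs
    have := hs.sign
    simp only [hl, false_and, or_false] at this
    omega
  rw [hA, hB] at hb ha
  simp only [List.nil_append, List.append_nil, List.cons.injEq, and_true] at hb ha
  refine ⟨l, r, by rw [← hx]; exact ha, hl, hb, fun h0 => ?_, fun h0 => ?_⟩
  · by_contra hr
    have hlast := hW.last h0
    rw [ha, List.getLast?_append, List.getLast?_cons] at hlast
    obtain ⟨r', y, rfl⟩ := (List.eq_nil_or_concat r).resolve_left hr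
    simp at hlast
    have := h.small_right y (by simp)
    omega
  · by_contra h1
    exact hs.right (by omega) h0 hB

/-! ### Words correspond to weighted paths -/

/-- The path `z` records the insertion of the letters `±1, …, ±n` of `W`. -/
def Encodes (e n : ℕ) (W : List ℤ) (z : Fin n → WStep) : Prop :=
  ∀ j : Fin n, ∃ A l x r B,
    IsStep e j (runs j W) (runs (j + 1) W) (z j) A l x r B

/-- From the common blocks of zeros, `IsStep.forward` gives equal blocks up to threshold n. The word
consists of these one or two blocks and the letter n + 1 after the first. -/
theorem Encodes.injective {e n : ℕ} (he : e ≤ 1) {W W' : List ℤ} {z : Fin n → WStep}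
    (hW : IsWord e n W) (hW' : IsWord e n W') (h : Encodes e n W z) (h' : Encodes e n W' z) :
    W = W' := by
  have key : ∀ k ≤ n, runs k W = runs k W' := by
    intro k hk
    induction k with
    | zero => rw [hW.runs_zero he, hW'.runs_zero he]
    | succ k ih =>
      obtain ⟨A, l, x, r, B, h1⟩ := h ⟨k, hk⟩
      obtain ⟨A', l', x', r', B', h2⟩ := h' ⟨k, hk⟩
      simp only [ih (by omega)] at h1
      exact h1.forward h2
  obtain ⟨l, r, h1, h2, h3, h4⟩ := hW.eq_append he
  obtain ⟨l', r', h1', h2', h3', h4'⟩ := hW'.eq_append he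
  have h5 := h3.symm.trans ((key n le_rfl).trans h3')
  rw [optBlock_of_ne h2, optBlock_of_ne h2'] at h5
  simp only [List.cons_append, List.nil_append, List.cons.injEq] at h5
  have h6 : r = r' := by
    have := congrArg List.flatten h5.2
    rwa [flatten_optBlock, flatten_optBlock] at this
  rw [h1, h1', h5.1, h6]

theorem Encodes.unique {e n : ℕ} {W : List ℤ} {z z' : Fin n → WStep}
    (h : Encodes e n W z) (h' : Encodes e n W z') : z = z' := by
  funext j
  obtain ⟨A, l, x, r, B, h1⟩ := h j
  obtain ⟨A', l', x', r', B', h2⟩ := h' j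
  exact (h1.backward h2).2

/-- The rise of the `j`-th step, and `0` after the end of the path. -/
def riseAt {n : ℕ} (z : Fin n → WStep) (j : ℕ) : ℤ :=
  if h : j < n then (z ⟨j, h⟩).kind.rise else 0

theorem sum_rise_eq {n : ℕ} (z : Fin n → WStep) :
    ∑ j, (z j).kind.rise = ∑ j ∈ Finset.range n, riseAt z j := by
  rw [← Fin.sum_univ_eq_sum_range]
  exact Finset.sum_congr rfl fun j _ => by simp [riseAt]

theorem height_eq {n : ℕ} (z : Fin n → WStep) (j : Fin n) :
    height z j = ∑ i ∈ Finset.range j, riseAt z i := by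
  unfold height
  refine Finset.sum_bij (fun i _ => (i : ℕ)) ?_ ?_ ?_ ?_
  · intro i hi; simpa using hi
  · intro i _ i' _ h; exact Fin.ext h
  · intro i hi
    have : i < j := by simpa using hi
    exact ⟨⟨i, by omega⟩, by simpa [Fin.lt_def] using this, rfl⟩
  · intro i _; simp [riseAt]

/-- The set of weighted paths of length `n`: `e = 0` for `Q_n`, `e = 1` for `R_n`. -/
def paths (e n : ℕ) : Set (Fin n → WStep) :=
  {z | IsMotzkin z ∧ ∀ j, Admissible e (height z j) (z j)}

/-- There are 1 + e blocks at the start and each step adds its rise: heights are numbers of blocks,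
shifted by 1 + e. -/
theorem Encodes.length_runs {e n : ℕ} (he : e ≤ 1) {W : List ℤ} {z : Fin n → WStep}
    (hW : IsWord e n W) (h : Encodes e n W z) {k : ℕ} (hk : k ≤ n) :
    ((runs k W).length : ℤ) = ∑ i ∈ Finset.range k, riseAt z i + 1 + e := by
  induction k with
  | zero => rw [hW.runs_zero he]; simp
  | succ k ih =>
    obtain ⟨A, l, x, r, B, h1⟩ := h ⟨k, hk⟩
    have h2 := h1.length_add
    simp only at h2
    rw [h2, ih (by omega), Finset.sum_range_succ, riseAt, dif_pos (show k < n by omega)]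
    ring

/-- The letter n + 1 cuts the word; the initial 0 gives a block on its left and, for e = 1, the
final 0 gives one on its right. This keeps the path above the axis. -/
theorem IsWord.le_length_runs {e n : ℕ} (he : e ≤ 1) {W : List ℤ} (hW : IsWord e n W) {k : ℕ}
    (hk : k ≤ n) : 1 + e ≤ (runs k W).length := by
  obtain ⟨M, hM, -⟩ := hW.eq_zero_cons
  obtain ⟨l, r, h1, h2, -, h4⟩ := hW.eq_append he
  have hl : runs k l ≠ [] := by
    obtain ⟨y, l, rfl⟩ := List.exists_cons_of_ne_nil h2
    have := h1.symm.trans hM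
    simp at this
    exact runs_ne_nil (y := y) (by simp) (by simp [this.1])
  have e1 : runs k W = runs k l ++ runs k r := by
    rw [h1, runs_append_cons (by omega)]
  have hl' := List.length_pos_iff.2 hl
  rw [e1, List.length_append]
  obtain rfl | rfl : e = 0 ∨ e = 1 := by omega
  · omega
  · have hr : r ≠ [] := fun h0 => by simpa using h4.2 h0
    obtain ⟨r, y, rfl⟩ := (List.eq_nil_or_concat r).resolve_left hr
    have h5 := congrArg List.getLast? (h1.symm.trans hM)
    have h6 : y = 0 := by
      simp [List.getLast?_append, List.getLast?_cons] at h5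
      exact h5
    have hr : runs k (r.concat y) ≠ [] := runs_ne_nil (y := y) (by simp) (by simp [h6])
    have := List.length_pos_iff.2 hr
    omega

theorem Encodes.mem_paths {e n : ℕ} (he : e ≤ 1) {W : List ℤ} {z : Fin n → WStep}
    (hW : IsWord e n W) (h : Encodes e n W z) : z ∈ paths e n := by
  refine ⟨⟨fun j => ?_, ?_⟩, fun j => ?_⟩
  · have h1 := h.length_runs he hW (k := j) (by omega)
    have h2 := hW.le_length_runs he (k := j) (by omega)
    rw [height_eq]
    omega
  · have h1 := h.length_runs he hW le_rfl
    obtain ⟨l, r, h3, h4, h5, h6⟩ := hW.eq_append he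
    rw [sum_rise_eq]
    have h7 : (runs n W).length = 1 + e := by
      rw [h5, optBlock_of_ne h4]
      obtain rfl | rfl : e = 0 ∨ e = 1 := by omega
      · simp [h6.1 rfl, optBlock]
      · rw [optBlock_of_ne (by simpa using h6.not)]; simp
    omega
  · obtain ⟨A, l, x, r, B, h1⟩ := h j
    have h2 := h1.admissible he (hW.le_length_runs he (by omega))
    have h3 := h.length_runs he hW (k := j) (by omega)
    rw [height_eq]
    rw [h3] at h2
    convert h2 using 1
    ring

theorem isConfig_zero {e : ℕ} (he : e ≤ 1) : IsConfig e 0 (List.replicate (1 + e) [0]) := by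
  refine ⟨by simp, by simp, [], ?_, by simp⟩
  obtain rfl | rfl : e = 0 ∨ e = 1 := by omega
  · simp
  · simp [List.replicate]

/-- The steps are performed one after another from the blocks of zeros, and n + 1 is put in at the
end. It remains to see that the lists so constructed are the runs of the resulting word. -/
theorem exists_encodes {e n : ℕ} (he : e ≤ 1) {z : Fin n → WStep} (hz : z ∈ paths e n) :
    ∃ W, IsWord e n W ∧ Encodes e n W z := by
  obtain ⟨⟨h0, hend⟩, hadm⟩ := hz
  have hpos : ∀ k ≤ n, 0 ≤ ∑ i ∈ Finset.range k, riseAt z i := by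
    intro k hk
    rcases hk.lt_or_eq with hk | rfl
    · simpa [height_eq] using h0 ⟨k, hk⟩
    · rw [← sum_rise_eq, hend]
  -- the sequence of configurations
  have step : ∀ (j : Fin n) (c : List (List ℤ)), ∃ c' : List (List ℤ), IsConfig e j c →
      (c.length : ℤ) = height z j + 1 + e → ∃ A l x r B, IsStep e j c c' (z j) A l x r B := by
    intro j c
    by_cases hc : IsConfig e j c ∧ (c.length : ℤ) = height z j + 1 + e
    · obtain ⟨h, hh⟩ := Int.eq_ofNat_of_zero_le (h0 j)
      obtain ⟨c', h'⟩ := hc.1.exists_isStep he (h := h) (s := z j) (by omega)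
        (by simpa [hh] using hadm j)
      exact ⟨c', fun _ _ => h'⟩
    -- Elsewhere the value is arbitrary; this makes `next` a total function.
    · exact ⟨c, fun h1 h2 => absurd ⟨h1, h2⟩ hc⟩
  choose next hnext using step
  let c : ℕ → List (List ℤ) := fun k =>
    Nat.rec (List.replicate (1 + e) [0]) (fun j c => if h : j < n then next ⟨j, h⟩ c else c) k
  have hc0 : c 0 = List.replicate (1 + e) [0] := rfl
  have hcs : ∀ j : Fin n, c (j + 1) = next j (c j) := fun j => by
    change (if h : (j : ℕ) < n then next ⟨j, h⟩ (c j) else c j) = _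
    simp
  have main : ∀ k ≤ n, IsConfig e k (c k) ∧
      ((c k).length : ℤ) = ∑ i ∈ Finset.range k, riseAt z i + 1 + e := by
    intro k hk
    induction k with
    | zero => exact ⟨isConfig_zero he, by simp [hc0]⟩
    | succ k ih =>
      obtain ⟨ih1, ih2⟩ := ih (by omega)
      obtain ⟨A, l, x, r, B, h1⟩ := hnext ⟨k, hk⟩ (c k) ih1 (by rw [ih2, height_eq])
      rw [← hcs ⟨k, hk⟩] at h1
      refine ⟨h1.isConfig he ih1, ?_⟩
      have h2 := h1.length_add
      simp only at h2
      rw [h2, ih2, Finset.sum_range_succ, riseAt, dif_pos (show k < n by omega)]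
      ring
  have hstep : ∀ j : Fin n, ∃ A l x r B, IsStep e j (c j) (c (j + 1)) (z j) A l x r B := by
    intro j
    obtain ⟨h1, h2⟩ := main j (by omega)
    rw [hcs j]
    exact hnext j (c j) h1 (by rw [h2, height_eq])
  -- the insertion of the largest letter
  obtain ⟨hcn, hlen⟩ := main n le_rfl
  rw [← sum_rise_eq, hend] at hlen
  obtain ⟨l, r, hlr, hl, hr⟩ : ∃ l r, c n = [] ++ optBlock l ++ optBlock r ++ [] ∧ l ≠ [] ∧
      (e = 0 ↔ r = []) := by
    have hne := hcn.ne_nil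
    obtain rfl | rfl : e = 0 ∨ e = 1 := by omega
    · obtain ⟨l, hl⟩ := List.length_eq_one_iff.1 (show (c n).length = 1 by omega)
      have := hne l (by simp [hl])
      exact ⟨l, [], by simp [hl, optBlock, this], this, by simp⟩
    · obtain ⟨l, r, hl⟩ := List.length_eq_two.1 (show (c n).length = 2 by omega)
      have h1 := hne l (by simp [hl])
      have h2 := hne r (by simp [hl])
      exact ⟨l, r, by simp [hl, optBlock, h1, h2], h1, by simp [h2]⟩
  have hcfg := hcn.insert he (x := (n : ℤ) + 1) hlr (by omega) (Or.inl (by omega))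
    (fun h => absurd h hl) (fun h1 h2 => absurd (hr.2 h2) (by omega))
  set W := l ++ ((n : ℤ) + 1) :: r with hWdef
  have hW : IsWord e n W := ⟨by simpa using hcfg, fun h => by simp [hWdef, hr.1 h]⟩
  have hsmall : ∀ y ∈ l ++ r, y.natAbs ≤ n := by
    intro y hy
    refine hcn.abs_le ?_
    rw [hlr]
    simpa [flatten_optBlock] using hy
  -- Downward induction on the threshold: once `runs` and `c` agree at k + 1, they agree at k
  -- because a step can be undone in only one way.
  have hruns : ∀ m ≤ n, runs (n - m) W = c (n - m) := by
    intro m hm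
    induction m with
    | zero =>
      have h1 := runs_of_small (k := n) (b := l) fun y hy => hsmall y (by simp [hy])
      have h2 := runs_of_small (k := n) (b := r) fun y hy => hsmall y (by simp [hy])
      rw [Nat.sub_zero, hWdef, runs_append_cons (by omega), h1, h2, hlr]
      simp
    | succ m ih =>
      have ih := ih (by omega)
      obtain ⟨k, hk⟩ : ∃ k, k = n - (m + 1) := ⟨_, rfl⟩
      rw [show n - m = k + 1 by omega] at ih
      rw [← hk]
      obtain ⟨U, l', x, r', V, hf⟩ := hW.exists_factorization (k := k) (by omega)
      have h1 := hf.isStep hW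
      obtain ⟨A, l, x, r, B, h2⟩ := hstep ⟨k, by omega⟩
      simp only at h2
      rw [ih] at h1
      exact (h1.backward h2).1
  have hruns' : ∀ k ≤ n, runs k W = c k := fun k hk => by
    have := hruns (n - k) (by omega)
    rwa [show n - (n - k) = k by omega] at this
  refine ⟨W, hW, fun j => ?_⟩
  rw [hruns' j (by omega), hruns' (j + 1) (by omega)]
  exact hstep j

end SnakeEuler

namespace SnakeEuler

open Finset

/-! ### Words as functions of the position -/

/-- The factor `f a, …, f (a + m - 1)`. -/
def seg (f : ℕ → ℤ) (a m : ℕ) : List ℤ := (List.range' a m).map f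

theorem seg_zero (f : ℕ → ℤ) (a : ℕ) : seg f a 0 = [] := rfl

theorem seg_succ (f : ℕ → ℤ) (a m : ℕ) : seg f a (m + 1) = f a :: seg f (a + 1) m := by
  simp [seg, List.range'_succ]

@[simp] theorem length_seg (f : ℕ → ℤ) (a m : ℕ) : (seg f a m).length = m := by simp [seg]

theorem seg_append (f : ℕ → ℤ) (a m m' : ℕ) :
    seg f a m ++ seg f (a + m) m' = seg f a (m + m') := by
  simp only [seg, ← List.map_append, List.range'_append_1]

theorem mem_seg {f : ℕ → ℤ} {a m : ℕ} {y : ℤ} :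
    y ∈ seg f a m ↔ ∃ j, a ≤ j ∧ j < a + m ∧ f j = y := by
  simp [seg, and_assoc]

theorem seg_eq_append {f : ℕ → ℤ} {a m : ℕ} {X Y : List ℤ} (h : seg f a m = X ++ Y) :
    X = seg f a X.length ∧ Y = seg f (a + X.length) Y.length ∧ m = X.length + Y.length := by
  have hm : m = X.length + Y.length := by simpa using congrArg List.length h
  subst hm
  rw [← seg_append] at h
  obtain ⟨h1, h2⟩ := List.append_inj h (by simp)
  exact ⟨h1.symm, h2.symm, rfl⟩

theorem head?_seg (f : ℕ → ℤ) (a m : ℕ) : (seg f a (m + 1)).head? = some (f a) := by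
  simp [seg_succ]

theorem getLast?_seg (f : ℕ → ℤ) (a m : ℕ) : (seg f a (m + 1)).getLast? = some (f (a + m)) := by
  rw [← seg_append f a m 1, seg_succ, seg_zero]; simp

theorem length_runs_cons (k : ℕ) (x : ℤ) (W : List ℤ) :
    (runs k (x :: W)).length =
      (if x.natAbs ≤ k ∧ ∀ y ∈ W.head?, k < y.natAbs then 1 else 0) + (runs k W).length := by
  by_cases hx : x.natAbs ≤ k
  · rcases W with _ | ⟨y, W⟩
    · simp [runs, hx]
    · by_cases hy : y.natAbs ≤ k
      · obtain ⟨b, B, hb⟩ := List.exists_cons_of_ne_nil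
          (runs_ne_nil (W := y :: W) (List.mem_cons_self) hy)
        rw [runs]
        simp [hx, hy, hb]
      · rw [runs]
        simp [hx, hy]
        split_ifs <;> omega
  · rw [runs]
    simp [hx]

/-- The number of runs is the number of their last letters. -/
theorem length_runs_seg (f : ℕ → ℤ) (k a m : ℕ) :
    (runs k (seg f a m)).length =
      #{j ∈ Finset.Ico a (a + m) | (f j).natAbs ≤ k ∧ (j + 1 = a + m ∨ k < (f (j + 1)).natAbs)} := by
  induction m generalizing a with
  | zero => simp [seg, runs]
  | succ m ih =>
    rw [seg_succ, length_runs_cons, ih, Finset.card_filter, Finset.card_filter,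
      Finset.sum_eq_sum_Ico_succ_bot (show a < a + (m + 1) by omega),
      show a + (m + 1) = a + 1 + m by ring]
    congr 1
    rcases m with _ | m
    · simp [seg]
    · simp [seg_succ]

/-- The number of runs is the number of their first letters. -/
theorem length_runs_seg' (f : ℕ → ℤ) (k a m : ℕ) :
    (runs k (seg f a m)).length =
      #{j ∈ Finset.Ico a (a + m) | j + 1 < a + m ∧ k < (f j).natAbs ∧ (f (j + 1)).natAbs ≤ k} +
        if 0 < m ∧ (f a).natAbs ≤ k then 1 else 0 := by
  induction m generalizing a with
  | zero => simp [seg, runs]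
  | succ m ih =>
    rw [seg_succ, length_runs_cons, ih, Finset.card_filter, Finset.card_filter,
      Finset.sum_eq_sum_Ico_succ_bot (show a < a + (m + 1) by omega),
      show a + (m + 1) = a + 1 + m by ring]
    rcases m with _ | m
    · simp [seg]
    · simp only [head?_seg, Option.mem_def, Option.some.injEq, forall_eq']
      split_ifs <;> omega

/-- The number of blocks in terms of their last letters. -/
theorem card_blocks_filter (n : ℕ) (p : ℕ → ℕ) (k : ℕ) (c : ℕ → Prop) [DecidablePred c] :
    #{I ∈ blocks n p k | c I.2} =
      #{j ∈ Finset.range (n + 2) | (p j ≤ k ∧ (j = n + 1 ∨ k < p (j + 1))) ∧ c j} := by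
  refine Finset.card_bij (fun I _ => I.2) ?_ ?_ ?_
  · rintro ⟨a, b⟩ h
    simp only [blocks, Finset.mem_filter, Finset.mem_product, Finset.mem_range,
      Finset.mem_Icc] at h ⊢
    obtain ⟨⟨⟨h1, h2⟩, h3, h4, h5, h6⟩, h7⟩ := h
    exact ⟨h2, ⟨h4 b ⟨h3, le_rfl⟩, h6⟩, h7⟩
  · rintro ⟨a, b⟩ h ⟨a', b'⟩ h' (rfl : b = b')
    simp only [blocks, Finset.mem_filter, Finset.mem_product, Finset.mem_range,
      Finset.mem_Icc] at h h'
    obtain ⟨⟨-, h3, h4, h5, -⟩, -⟩ := h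
    obtain ⟨⟨-, h3', h4', h5', -⟩, -⟩ := h'
    have : a = a' := by
      rcases lt_trichotomy a a' with hlt | heq | hlt
      · have := h4 (a' - 1) ⟨by omega, by omega⟩
        omega
      · exact heq
      · have := h4' (a - 1) ⟨by omega, by omega⟩
        omega
    rw [this]
  · intro b hb
    simp only [Finset.mem_filter, Finset.mem_range] at hb
    obtain ⟨h1, ⟨h2, h3⟩, h4⟩ := hb
    -- Walking left from b finds the start of its block.
    have key : ∀ b, p b ≤ k → ∃ a ≤ b, (∀ i ∈ Finset.Icc a b, p i ≤ k) ∧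
        (a = 0 ∨ k < p (a - 1)) := by
      intro b
      induction b with
      | zero => exact fun h => ⟨0, le_rfl, by simpa using h, Or.inl rfl⟩
      | succ b ih =>
        intro h
        by_cases hb : p b ≤ k
        · obtain ⟨a, ha, h5, h6⟩ := ih hb
          refine ⟨a, by omega, fun i hi => ?_, h6⟩
          rw [Finset.mem_Icc] at hi
          rcases eq_or_ne i (b + 1) with rfl | hne
          · exact h
          · exact h5 i (Finset.mem_Icc.2 (by omega))
        · refine ⟨b + 1, le_rfl, by simpa using h, Or.inr (by simpa using hb)⟩
    obtain ⟨a, ha, h5, h6⟩ := key b h2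
    refine ⟨(a, b), ?_, rfl⟩
    simp only [blocks, Finset.mem_filter, Finset.mem_product, Finset.mem_range]
    exact ⟨⟨⟨by omega, h1⟩, ha, h5, h6, h3⟩, h4⟩

/-- The letters with alternating signs: `w` is a snake if consecutive letters of `tau w` have
positive sums. -/
def tau (w : ℕ → ℤ) (i : ℕ) : ℤ := (-1) ^ (i + 1) * w i

theorem natAbs_tau (w : ℕ → ℤ) (i : ℕ) : (tau w i).natAbs = absWord w i := by
  simp [tau, absWord, Int.natAbs_mul]

/-- Neighbouring positions carry opposite alternating signs, so a sign change in `w` means equal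
signs in `tau w`. -/
theorem mul_eq_neg_tau (w : ℕ → ℤ) (i : ℕ) : w i * w (i + 1) = -(tau w i * tau w (i + 1)) := by
  have h : ((-1 : ℤ) ^ i) * (-1) ^ i = 1 := by rw [← mul_pow]; simp
  simp only [tau, pow_succ]
  linear_combination (-(w i * w (i + 1))) * h

theorem alpha_eq_length_runs (N : ℕ) (w : ℕ → ℤ) (k : ℕ) :
    alpha N (absWord w) k = (runs k (seg (tau w) 0 (N + 2))).length := by
  have h := card_blocks_filter N (absWord w) k fun _ => True
  simp only [Finset.filter_true, and_true] at h
  rw [length_runs_seg, alpha, h]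
  simp only [natAbs_tau, Finset.range_eq_Ico, zero_add]
  exact congrArg card (Finset.filter_congr fun j _ => by omega)

/-- The statistics of a word at a position `i` whose letter has the absolute value `k + 1`. -/
structure LocalData (N : ℕ) (w : ℕ → ℤ) (k i : ℕ) (U l : List ℤ) (x : ℤ) (r V : List ℤ) :
    Prop where
  letter : tau w i = x
  left_nil : l = [] → absWord w i < absWord w (i - 1)
  left_ne : l ≠ [] → absWord w (i - 1) < absWord w i
  right_nil : r = [] → absWord w i < absWord w (i + 1)
  right_ne : r ≠ [] → absWord w (i + 1) < absWord w i
  alpha_eq : alpha N (absWord w) (absWord w i) = (runs k U).length + 1 + (runs k V).length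
  beta_eq : beta N (absWord w) i = (runs k V).length
  pat132_eq : pat132 (absWord w) i = (runs k U).length
  pat231_eq : pat231At N (absWord w) i = (runs k V).length

/-- If nonempty, `U` ends and `V` begins with a letter above the threshold. Hence each run of `U`
ends at a rise π_j < π_i < π_{j+1} and each run of `V` starts at a fall π_j > π_i > π_{j+1}, so 13-2
and 2-31 count the blocks on the two sides. -/
theorem IsFactorization.localData {N k : ℕ} {w : ℕ → ℤ} {U l r V : List ℤ} {x : ℤ}
    (h : IsFactorization k (seg (tau w) 0 (N + 2)) U l x r V) {i : ℕ} (hi : 1 ≤ i) (hiN : i ≤ N)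
    (hik : absWord w i = k + 1) : LocalData N w k i U l x r V := by
  have heq := h.eq
  obtain ⟨h1, hV, hlen1⟩ := seg_eq_append heq
  obtain ⟨hU, h2, hlen2⟩ := seg_eq_append h1.symm
  obtain ⟨hl, h3, hlen3⟩ := seg_eq_append h2.symm
  obtain ⟨u, hu⟩ : ∃ u, u = U.length := ⟨_, rfl⟩
  obtain ⟨m, hm⟩ : ∃ m, m = l.length := ⟨_, rfl⟩
  obtain ⟨m', hm'⟩ : ∃ m', m' = r.length := ⟨_, rfl⟩
  obtain ⟨m'', hm''⟩ : ∃ m'', m'' = V.length := ⟨_, rfl⟩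
  simp only [List.length_append, List.length_cons] at hlen1 hV h3 h2 hlen2
  rw [seg_succ, List.cons.injEq] at h3
  obtain ⟨hx, hr⟩ := h3
  simp only [← hu, ← hm, ← hm', ← hm'', zero_add] at hU hl hx hr hV hlen1
  have hfresh : ∀ j < N + 2, j ≠ u + m → absWord w j ≠ k + 1 := by
    intro j hj hne
    rw [← natAbs_tau]
    apply h.fresh
    simp only [List.mem_append]
    rw [hU, hl, hr, hV]
    simp only [mem_seg]
    by_cases h5 : j < u
    · exact Or.inl (Or.inl (Or.inl ⟨j, by omega, by omega, rfl⟩))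
    by_cases h6 : j < u + m
    · exact Or.inl (Or.inl (Or.inr ⟨j, by omega, by omega, rfl⟩))
    by_cases h7 : j < u + m + 1 + m'
    · exact Or.inl (Or.inr ⟨j, by omega, by omega, rfl⟩)
    · exact Or.inr ⟨j, by omega, by omega, rfl⟩
  have hi' : i = u + m := by
    by_contra hne
    exact hfresh i (by omega) hne hik
  have hsl : ∀ j, u ≤ j → j < i → absWord w j ≤ k := fun j h4 h5 => by
    rw [← natAbs_tau]
    exact h.small_left _ (by rw [hl]; exact mem_seg.2 ⟨j, by omega, by omega, rfl⟩)
  obtain ⟨v, hv⟩ : ∃ v, v = u + m + 1 + m' := ⟨_, rfl⟩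
  have hsr : ∀ j, i < j → j < v → absWord w j ≤ k := fun j h4 h5 => by
    rw [← natAbs_tau]
    exact h.small_right _ (by rw [hr]; exact mem_seg.2 ⟨j, by omega, by omega, rfl⟩)
  have hbl : 0 < u → k < absWord w (u - 1) := fun h4 => by
    rw [← natAbs_tau]
    apply h.big_left
    obtain ⟨u', rfl⟩ : ∃ u', u = u' + 1 := ⟨u - 1, by omega⟩
    rw [hU, getLast?_seg]; simp
  have hbr : v < N + 2 → k < absWord w v := fun h4 => by
    rw [← natAbs_tau]
    apply h.big_right
    obtain ⟨u', rfl⟩ : ∃ u', m'' = u' + 1 := ⟨m'' - 1, by omega⟩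
    rw [hV, head?_seg, hv]
    simp only [Option.mem_def, Option.some.injEq]
    congr 1; omega
  have hVv : V = seg (tau w) v m'' := by
    rw [hV]; congr 1; omega
  have hm0 : l = [] ↔ m = 0 := by rw [hm]; exact List.length_eq_zero_iff.symm
  have hm0' : r = [] ↔ m' = 0 := by rw [hm']; exact List.length_eq_zero_iff.symm
  have f1 := hfresh (i - 1) (by omega) (by omega)
  have f2 := hfresh (i + 1) (by omega) (by omega)
  have hbeta : beta N (absWord w) i = (runs k V).length := by
    have e1 : runs k V = runs (k + 1) V :=
      (runs_congr fun y hy => h.fresh y (by simp [hy])).symm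
    -- Here `v` is the position just after `r`. The positions from i to v - 1 lie in one block, so a
    -- block starts after i exactly when it ends at v or later.
    have e2 : beta N (absWord w) i = #{I ∈ blocks N (absWord w) (k + 1) | v ≤ I.2} := by
      unfold beta
      rw [hik]
      congr 1
      ext ⟨a, b⟩
      simp only [Finset.mem_filter, and_congr_right_iff]
      intro hI
      simp only [blocks, Finset.mem_filter, Finset.mem_product, Finset.mem_range,
        Finset.mem_Icc] at hI
      obtain ⟨⟨g1, g2⟩, g3, g4, g5, g6⟩ := hI
      constructor
      · intro g7
        by_contra g8
        have g9 : k + 1 < absWord w (a - 1) := by omega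
        rcases eq_or_ne i (a - 1) with rfl | hne
        · omega
        · have := hsr (a - 1) (by omega) (by omega)
          omega
      · intro g7
        by_contra g8
        have g9 := g4 v ⟨by omega, g7⟩
        have g10 := hbr (by omega)
        have g11 := hfresh v (by omega) (by omega)
        omega
    rw [e2, card_blocks_filter, e1, hVv, length_runs_seg]
    congr 1
    ext j
    simp only [Finset.mem_filter, Finset.mem_range, Finset.mem_Ico, natAbs_tau]
    have : j + 1 = v + m'' ↔ j = N + 1 := by omega
    rw [this]
    constructor
    · rintro ⟨g1, g2, g3⟩; exact ⟨⟨g3, by omega⟩, g2⟩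
    · rintro ⟨⟨g3, g1⟩, g2⟩; exact ⟨by omega, g2, g3⟩
  refine ⟨by rw [hx, hi'], fun h0 => ?_, fun h0 => ?_, fun h0 => ?_, fun h0 => ?_, ?_, hbeta, ?_, ?_⟩
  · have := hbl (by have := hm0.1 h0; omega)
    rw [show u - 1 = i - 1 by have := hm0.1 h0; omega] at this
    omega
  · have := hsl (i - 1) (by have := hm0.not.1 h0; omega) (by omega)
    omega
  · have := hbr (by have := hm0'.1 h0; omega)
    rw [show v = i + 1 by have := hm0'.1 h0; omega] at this
    omega
  · have := hsr (i + 1) (by omega) (by have := hm0'.not.1 h0; omega)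
    omega
  · rw [hik, alpha_eq_length_runs, heq, runs_append_block, optBlock_of_ne (by simp),
      runs_congr fun y hy => h.fresh y (by simp [hy]),
      runs_congr fun y hy => h.fresh y (by simp [hy])]
    · simp; ring
    · intro y hy
      simp only [List.mem_append, List.mem_cons] at hy
      rcases hy with hy | rfl | hy
      · have := h.small_left y hy; omega
      · exact h.abs.le
      · have := h.small_right y hy; omega
    · intro y hy
      have h1 := h.big_left y hy
      have h2 := h.fresh y (by simp [List.mem_of_getLast? hy])
      omega
    · intro y hy
      have h1 := h.big_right y hy
      have h2 := h.fresh y (by simp [List.mem_of_head? hy])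
      omega
  · rw [hU, length_runs_seg, pat132, hik]
    congr 1
    ext j
    simp only [Finset.mem_filter, Finset.mem_range, Finset.mem_Ico, natAbs_tau, zero_add]
    constructor
    · rintro ⟨g1, g2, g3, g4⟩
      have : j + 1 < u := by
        by_contra g5
        have := hsl (j + 1) (by omega) (by omega)
        omega
      exact ⟨by omega, by omega, Or.inr (by omega)⟩
    · rintro ⟨⟨-, g1⟩, g2, g3⟩
      rcases g3 with g3 | g3
      · have := hbl (by omega)
        rw [show u - 1 = j by omega] at this
        omega
      · have g4 : j + 1 ≠ u + m := by
          intro g4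
          have := hbl (by omega)
          rw [show u - 1 = j by omega] at this
          omega
        have := hfresh (j + 1) (by omega) g4
        omega
  · rw [hVv, length_runs_seg', if_neg, pat231At, hik, add_zero]
    · congr 1
      ext j
      simp only [Finset.mem_filter, Finset.mem_Ioc, Finset.mem_Ico, natAbs_tau]
      constructor
      · rintro ⟨g1, g2, g3⟩
        have : v ≤ j := by
          by_contra g5
          have := hsr j (by omega) (by omega)
          omega
        exact ⟨by omega, by omega, by omega, by omega⟩
      · rintro ⟨g1, g2, g3, g4⟩
        have := hfresh j (by omega) (by omega)
        exact ⟨by omega, by omega, by omega⟩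
    · rintro ⟨g1, g2⟩
      rw [natAbs_tau] at g2
      have := hbr (by omega)
      omega

end SnakeEuler

namespace SnakeEuler

open Finset

/-! ### Steps and statistics of a snake word -/

/-- The common form of `stepQ` (`e = 0`) and `stepR` (`e = 1`). -/
def stepOf (e : ℤ) (n : ℕ) (w : ℕ → ℤ) (i : ℕ) : WStep :=
  let p := absWord w
  let a : ℤ := alpha n p (p i)
  let b : ℤ := beta n p i
  if IsValley p i then
    if SignChanges w i then ⟨.U, 2, b + 2 * a - 3 - 2 * e⟩ else ⟨.U, 0, b - e⟩
  else if IsDoubleAscent p i then ⟨.L, 1, b + a - 1 - e⟩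
  else if IsDoubleDescent p i then ⟨.W, 1, b + a - 1 - e⟩
  else ⟨.D, 0, b⟩

theorem stepQ_eq (n : ℕ) (w : ℕ → ℤ) (i : ℕ) : stepQ n w i = stepOf 0 n w i := by
  simp [stepQ, stepOf]

theorem stepR_eq (n : ℕ) (w : ℕ → ℤ) (i : ℕ) : stepR n w i = stepOf 1 n w i := by
  simp only [stepR, stepOf]
  split_ifs <;> simp <;> ring

/-- At a valley both neighbours have larger absolute value and are therefore positive in `tau w`;
the sign of the valley letter decides both products at once. -/
theorem signChanges_iff {w : ℕ → ℤ} {i : ℕ} (hi : 1 ≤ i)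
    (h1 : 0 < tau w (i - 1) + tau w i) (h2 : 0 < tau w i + tau w (i + 1))
    (hv : IsValley (absWord w) i) : SignChanges w i ↔ 0 < tau w i := by
  obtain ⟨j, rfl⟩ : ∃ j, i = j + 1 := ⟨i - 1, by omega⟩
  obtain ⟨h3, h4⟩ := hv
  simp only [← natAbs_tau, Nat.add_sub_cancel] at h1 h3 h4
  have e1 : w (j + 1 - 1) * w (j + 1) = -(tau w j * tau w (j + 1)) := mul_eq_neg_tau w j
  unfold SignChanges
  rw [e1, mul_eq_neg_tau w (j + 1)]
  have p1 : 0 < tau w j := by omega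
  have p2 : 0 < tau w (j + 1 + 1) := by omega
  constructor
  · rintro ⟨h5, -⟩
    have : 0 < tau w j * tau w (j + 1) := by linarith
    exact (pos_iff_pos_of_mul_pos this).1 p1
  · intro h5
    exact ⟨neg_neg_of_pos (mul_pos p1 h5), neg_neg_of_pos (mul_pos h5 p2)⟩

theorem LocalData.stepOf_eq {e : ℤ} {N k i : ℕ} {w : ℕ → ℤ} {U l r V : List ℤ} {x : ℤ}
    (h : LocalData N w k i U l x r V) (hi : 1 ≤ i)
    (h1 : 0 < tau w (i - 1) + tau w i) (h2 : 0 < tau w i + tau w (i + 1)) :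
    stepOf e N w i
      = wstep e (kindOf l r) x (alpha N (absWord w) (absWord w i)) (runs k V).length := by
  have hs := signChanges_iff hi h1 h2
  simp only [stepOf, h.beta_eq, kindOf]
  by_cases hl : l = [] <;> by_cases hr : r = []
  · have a1 := h.left_nil hl
    have a2 := h.right_nil hr
    rw [if_pos (show IsValley (absWord w) i from ⟨a1, a2⟩)]
    simp only [hs ⟨a1, a2⟩, hl, hr, wstep, h.letter, if_true]
  · have a1 := h.left_nil hl
    have a2 := h.right_ne hr
    rw [if_neg (by rintro ⟨_, _⟩; omega), if_neg (by rintro ⟨_, _⟩; omega), if_pos ⟨a1, a2⟩]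
    simp [hl, hr, wstep]
  · have a1 := h.left_ne hl
    have a2 := h.right_nil hr
    rw [if_neg (by rintro ⟨_, _⟩; omega), if_pos ⟨a1, a2⟩]
    simp [hl, hr, wstep]
  · have a1 := h.left_ne hl
    have a2 := h.right_ne hr
    rw [if_neg (by rintro ⟨_, _⟩; omega), if_neg (by rintro ⟨_, _⟩; omega),
      if_neg (by rintro ⟨_, _⟩; omega)]
    simp [hl, hr, wstep]

/-- `w` is a word whose letters, with alternating signs, form the word of a snake. -/
structure IsSnakeWord (e n : ℕ) (w : ℕ → ℤ) : Prop where
  isWord : IsWord e n (seg (tau w) 0 (n + e + 2))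
  zero : tau w 0 = 0
  last_zero : e = 1 → tau w (n + 2) = 0
  last : e = 0 → tau w (n + 1) = n + 1
  pos : ∀ i ∈ Finset.Icc 1 (n + e), 1 ≤ absWord w i
  le : ∀ i ∈ Finset.Icc 1 (n + e), absWord w i ≤ n + 1
  adj : ∀ i ≤ n + e, 0 < tau w i + tau w (i + 1)

theorem IsSnakeWord.exists_localData {e n : ℕ} {w : ℕ → ℤ} (h : IsSnakeWord e n w) {i : ℕ}
    (hi : i ∈ Finset.Icc 1 (n + e)) : ∃ k U l x r V,
      IsFactorization k (seg (tau w) 0 (n + e + 2)) U l x r V ∧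
      absWord w i = k + 1 ∧ LocalData (n + e) w k i U l x r V := by
  have h1 := h.pos i hi
  have h2 := h.le i hi
  obtain ⟨k, hk⟩ : ∃ k, absWord w i = k + 1 := ⟨absWord w i - 1, by omega⟩
  obtain ⟨U, l, x, r, V, hf⟩ := h.isWord.exists_factorization (k := k) (by omega)
  rw [Finset.mem_Icc] at hi
  exact ⟨k, U, l, x, r, V, hf, hk, hf.localData hi.1 hi.2 hk⟩

theorem IsSnakeWord.isStep {e n : ℕ} {w : ℕ → ℤ} (h : IsSnakeWord e n w) {i k : ℕ}
    (hi : i ∈ Finset.Icc 1 (n + e)) (hk : absWord w i = k + 1) :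
    ∃ A l x r B, IsStep e k (runs k (seg (tau w) 0 (n + e + 2)))
      (runs (k + 1) (seg (tau w) 0 (n + e + 2))) (stepOf e (n + e) w i) A l x r B := by
  obtain ⟨k', U, l, x, r, V, hf, hk', hd⟩ := h.exists_localData hi
  obtain rfl : k = k' := by omega
  rw [Finset.mem_Icc] at hi
  have h1 := h.adj (i - 1) (by omega)
  rw [show i - 1 + 1 = i by omega] at h1
  refine ⟨runs k U, l, x, r, runs k V, ?_⟩
  rw [hd.stepOf_eq hi.1 h1 (h.adj i hi.2), hk, alpha_eq_length_runs]
  exact hf.isStep h.isWord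

theorem IsSnakeWord.ne_left {e n : ℕ} {w : ℕ → ℤ} (h : IsSnakeWord e n w) {i : ℕ}
    (hi : i ∈ Finset.Icc 1 (n + e)) : absWord w (i - 1) ≠ absWord w i := by
  obtain ⟨k, U, l, x, r, V, -, -, hd⟩ := h.exists_localData hi
  by_cases hl : l = []
  · have := hd.left_nil hl; omega
  · have := hd.left_ne hl; omega

theorem IsSnakeWord.ne_right {e n : ℕ} {w : ℕ → ℤ} (h : IsSnakeWord e n w) {i : ℕ}
    (hi : i ∈ Finset.Icc 1 (n + e)) : absWord w (i + 1) ≠ absWord w i := by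
  obtain ⟨k, U, l, x, r, V, -, -, hd⟩ := h.exists_localData hi
  by_cases hl : r = []
  · have := hd.right_nil hl; omega
  · have := hd.right_ne hl; omega

theorem IsSnakeWord.alpha_beta {e n : ℕ} {w : ℕ → ℤ} (h : IsSnakeWord e n w) {i : ℕ}
    (hi : i ∈ Finset.Icc 1 (n + e)) :
    (alpha (n + e) (absWord w) (absWord w i) : ℤ)
      = pat132 (absWord w) i + pat231At (n + e) (absWord w) i + 1 ∧
    (beta (n + e) (absWord w) i : ℤ) = pat231At (n + e) (absWord w) i := by
  obtain ⟨k, U, l, x, r, V, -, -, hd⟩ := h.exists_localData hi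
  rw [hd.alpha_eq, hd.beta_eq, hd.pat132_eq, hd.pat231_eq]
  constructor
  · push_cast; ring
  · rfl

theorem IsSnakeWord.sum_qExp_zero {e n : ℕ} {w : ℕ → ℤ} (h : IsSnakeWord e n w) :
    ∑ i ∈ Finset.Icc 1 (n + e), (stepOf 0 (n + e) w i).qExp
      = pat231 (n + e) (absWord w) + patQ (n + e) w := by
  unfold pat231 patQ setX setY
  rw [Finset.sum_filter, Finset.sum_filter, Finset.card_filter]
  push_cast
  rw [← Finset.sum_sub_distrib, ← Finset.sum_add_distrib, ← Finset.sum_add_distrib]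
  refine Finset.sum_congr rfl fun i hi => ?_
  obtain ⟨h1, h2⟩ := h.alpha_beta hi
  simp only [stepOf, h1, h2]
  by_cases hv : IsValley (absWord w) i
  · have hY : ¬ (IsDoubleAscent (absWord w) i ∨ IsDoubleDescent (absWord w) i) := by
      obtain ⟨_, _⟩ := hv
      rintro (⟨_, _⟩ | ⟨_, _⟩) <;> omega
    by_cases hs : SignChanges w i
    · rw [if_pos hv, if_pos hs, if_pos (And.intro hv hs), if_pos (And.intro hv hs), if_neg hY]
      ring
    · rw [if_pos hv, if_neg hs, if_neg (not_and_of_not_right _ hs),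
        if_neg (not_and_of_not_right _ hs), if_neg hY]
      ring
  · by_cases ha : IsDoubleAscent (absWord w) i
    · rw [if_neg hv, if_pos ha, if_neg (not_and_of_not_left _ hv),
        if_neg (not_and_of_not_left _ hv), if_pos (Or.inl ha)]
      ring
    · by_cases hd : IsDoubleDescent (absWord w) i
      · rw [if_neg hv, if_neg ha, if_pos hd, if_neg (not_and_of_not_left _ hv),
          if_neg (not_and_of_not_left _ hv), if_pos (Or.inr hd)]
        ring
      · rw [if_neg hv, if_neg ha, if_neg hd, if_neg (not_and_of_not_left _ hv),
          if_neg (not_and_of_not_left _ hv), if_neg (not_or.2 ⟨ha, hd⟩)]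
        ring

/-- With α = s + 1, adding 1 turns β + 2α - 5 into β + 2(s - 1), β - 1 into β, and β + α - 2 into β
+ s. The 1 added at each peak produces the term #Z. -/
theorem IsSnakeWord.sum_qExp_one {e n : ℕ} {w : ℕ → ℤ} (h : IsSnakeWord e n w) :
    ∑ i ∈ Finset.Icc 1 (n + e), ((stepOf 1 (n + e) w i).qExp + 1)
      = pat231 (n + e) (absWord w) + patR (n + e) w := by
  unfold pat231 patR setX setY setZ
  rw [Finset.sum_filter, Finset.sum_filter, Finset.card_filter]
  push_cast
  rw [← Finset.sum_add_distrib, ← Finset.sum_add_distrib, ← Finset.sum_add_distrib]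
  refine Finset.sum_congr rfl fun i hi => ?_
  obtain ⟨h1, h2⟩ := h.alpha_beta hi
  have hl := h.ne_left hi
  have hr := h.ne_right hi
  simp only [stepOf, h1, h2]
  by_cases hv : IsValley (absWord w) i
  · have hY : ¬ (IsDoubleAscent (absWord w) i ∨ IsDoubleDescent (absWord w) i) := by
      obtain ⟨_, _⟩ := hv
      rintro (⟨_, _⟩ | ⟨_, _⟩) <;> omega
    have hZ : ¬ IsPeak (absWord w) i := by
      obtain ⟨_, _⟩ := hv
      rintro ⟨_, _⟩; omega
    by_cases hs : SignChanges w i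
    · rw [if_pos hv, if_pos hs, if_pos (And.intro hv hs), if_neg hY, if_neg hZ]; ring
    · rw [if_pos hv, if_neg hs, if_neg (not_and_of_not_right _ hs), if_neg hY, if_neg hZ]; ring
  · by_cases ha : IsDoubleAscent (absWord w) i
    · have hZ : ¬ IsPeak (absWord w) i := by
        obtain ⟨_, _⟩ := ha
        rintro ⟨_, _⟩; omega
      rw [if_neg hv, if_pos ha, if_neg (not_and_of_not_left _ hv), if_pos (Or.inl ha), if_neg hZ]
      ring
    · by_cases hd : IsDoubleDescent (absWord w) i
      · have hZ : ¬ IsPeak (absWord w) i := by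
          obtain ⟨_, _⟩ := hd
          rintro ⟨_, _⟩; omega
        rw [if_neg hv, if_neg ha, if_pos hd, if_neg (not_and_of_not_left _ hv),
          if_pos (Or.inr hd), if_neg hZ]
        ring
      · have hZ : IsPeak (absWord w) i := by
          simp only [IsValley, IsDoubleAscent, IsDoubleDescent] at hv ha hd
          constructor <;> omega
        rw [if_neg hv, if_neg ha, if_neg hd, if_neg (not_and_of_not_left _ hv),
          if_neg (not_or.2 ⟨ha, hd⟩), if_pos hZ]
        ring

/-- A positive letter is charged once for each larger neighbour: twice at a positive valley, once at
a double ascent or descent, where positivity is automatic, and never at a peak. -/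
theorem IsSnakeWord.tExp_stepOf {e n : ℕ} {e' : ℤ} {w : ℕ → ℤ} (h : IsSnakeWord e n w) {i : ℕ}
    (hi : i ∈ Finset.Icc 1 (n + e)) :
    (stepOf e' (n + e) w i).tExp =
      (if absWord w i < absWord w (i - 1) ∧ 0 < tau w i then 1 else 0) +
        if absWord w i < absWord w (i + 1) ∧ 0 < tau w i then 1 else 0 := by
  obtain ⟨k, U, l, x, r, V, -, hk, hd⟩ := h.exists_localData hi
  rw [Finset.mem_Icc] at hi
  have a1 := h.adj (i - 1) (by omega)
  rw [show i - 1 + 1 = i by omega] at a1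
  have a2 := h.adj i hi.2
  rw [hd.stepOf_eq hi.1 a1 a2]
  unfold kindOf
  rw [← hd.letter]
  by_cases hl : l = [] <;> by_cases hr : r = []
  · have b1 := hd.left_nil hl
    have b2 := hd.right_nil hr
    simp only [hl, hr, if_true, wstep, b1, b2, true_and]
    split_ifs <;> simp
  · have b1 := hd.left_nil hl
    have b2 := hd.right_ne hr
    have : 0 < tau w i := by rw [← natAbs_tau, ← natAbs_tau] at b2; omega
    simp [hl, hr, wstep, b1, b2.not_gt, this]
  · have b1 := hd.left_ne hl
    have b2 := hd.right_nil hr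
    have : 0 < tau w i := by rw [← natAbs_tau, ← natAbs_tau] at b1; omega
    simp [hl, hr, wstep, b1.not_gt, b2, this]
  · have b1 := hd.left_ne hl
    have b2 := hd.right_ne hr
    simp [hl, hr, wstep, b1.not_gt, b2.not_gt]

theorem sum_Icc_one_eq (N : ℕ) (f : ℕ → ℤ) :
    ∑ i ∈ Finset.Icc 1 N, f i = ∑ i ∈ Finset.range N, f (i + 1) := by
  rw [← Finset.Ico_add_one_right_eq_Icc, Finset.sum_Ico_eq_sum_range]
  simp [add_comm]

/-- Neighbours of `w` have opposite signs exactly when both are positive in `tau w`. The larger one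
always is, so the pair can be charged to the smaller. -/
theorem IsSnakeWord.sum_tExp {e n : ℕ} (he : e ≤ 1) {e' : ℤ} {w : ℕ → ℤ}
    (h : IsSnakeWord e n w) :
    ∑ i ∈ Finset.Icc 1 (n + e), (stepOf e' (n + e) w i).tExp = cs (n + e) w := by
  rw [Finset.sum_congr rfl fun i hi => h.tExp_stepOf hi, Finset.sum_add_distrib, cs,
    Finset.card_filter, sum_Icc_one_eq, sum_Icc_one_eq]
  push_cast
  have key : ∀ i ∈ Finset.range (n + e + 1),
      (if w i * w (i + 1) < 0 then (1 : ℤ) else 0) =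
        (if absWord w (i + 1) < absWord w i ∧ 0 < tau w (i + 1) then 1 else 0) +
        if absWord w i < absWord w (i + 1) ∧ 0 < tau w i then 1 else 0 := by
    intro i hi
    rw [Finset.mem_range] at hi
    have a := h.adj i (by omega)
    have hne : absWord w i ≠ absWord w (i + 1) := by
      rcases Nat.eq_zero_or_pos i with rfl | h0
      · rcases Nat.eq_zero_or_pos (n + e) with h0 | h0
        · obtain ⟨rfl, rfl⟩ : n = 0 ∧ e = 0 := by omega
          simp only [← natAbs_tau, h.zero, h.last rfl]; simp
        · exact h.ne_left (i := 1) (Finset.mem_Icc.2 (by omega))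
      · exact (h.ne_right (Finset.mem_Icc.2 (by omega))).symm
    simp only [mul_eq_neg_tau w i, neg_lt_zero]
    rw [← natAbs_tau, ← natAbs_tau] at hne ⊢
    rcases lt_or_gt_of_ne hne with hlt | hlt
    · have p : 0 < tau w (i + 1) := by omega
      simp [mul_pos_iff_of_pos_right p, hlt, hlt.not_gt]
    · have p : 0 < tau w i := by omega
      simp [mul_pos_iff_of_pos_left p, hlt, hlt.not_gt]
  rw [Finset.sum_congr rfl key, Finset.sum_add_distrib,
    Finset.sum_range_succ (fun i => if absWord w (i + 1) < absWord w i ∧ 0 < tau w (i + 1)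
      then (1 : ℤ) else 0),
    Finset.sum_range_succ' (fun i => if absWord w i < absWord w (i + 1) ∧ 0 < tau w i
      then (1 : ℤ) else 0)]
  -- The end positions receive no charge: the first letter is 0, the last one is 0 or the largest.
  have z1 : ¬ (absWord w (n + e + 1) < absWord w (n + e) ∧ 0 < tau w (n + e + 1)) := by
    obtain rfl | rfl : e = 0 ∨ e = 1 := by omega
    · rintro ⟨h1, -⟩
      rw [← natAbs_tau, add_zero, h.last rfl] at h1
      rcases Nat.eq_zero_or_pos n with rfl | h0
      · rw [← natAbs_tau, h.zero] at h1; simp at h1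
      · have := h.le n (Finset.mem_Icc.2 (by omega))
        omega
    · rintro ⟨-, h1⟩
      rw [h.last_zero rfl] at h1
      exact lt_irrefl _ h1
  have z2 : ¬ (absWord w 0 < absWord w (0 + 1) ∧ 0 < tau w 0) := by
    rw [h.zero]; simp
  rw [if_neg z1, if_neg z2]
  simp

end SnakeEuler

namespace SnakeEuler

open Finset

/-! ### Signed permutations and their entries -/

theorem mem_signedRange {n : ℕ} {k : ℤ} : k ∈ signedRange n ↔ k ≠ 0 ∧ k.natAbs ≤ n := by
  simp only [signedRange, Finset.mem_erase, Finset.mem_Icc]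
  omega

theorem natCast_mem_signedRange {n i : ℕ} (hi : i ∈ Finset.Icc 1 n) : (i : ℤ) ∈ signedRange n := by
  rw [Finset.mem_Icc] at hi
  rw [mem_signedRange]; omega

theorem entry_eq {n : ℕ} (σ : SignedPerm n) {i : ℤ} (hi : i ∈ signedRange n) :
    entry σ i = (σ.1 ⟨i, hi⟩ : ℤ) := dif_pos hi

theorem entry_zero {n : ℕ} (σ : SignedPerm n) : entry σ 0 = 0 :=
  dif_neg (by simp [mem_signedRange])

theorem entry_mem {n : ℕ} (σ : SignedPerm n) {i : ℕ} (hi : i ∈ Finset.Icc 1 n) :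
    (entry σ i).natAbs ∈ Finset.Icc 1 n := by
  rw [entry_eq σ (natCast_mem_signedRange hi), Finset.mem_Icc]
  have := mem_signedRange.1 (σ.1 ⟨i, natCast_mem_signedRange hi⟩).2
  omega

theorem entry_neg {n : ℕ} (σ : SignedPerm n) (i : ℤ) : entry σ (-i) = -entry σ i := by
  by_cases hi : i ∈ signedRange n
  · have hi' : -i ∈ signedRange n := by
      rw [mem_signedRange] at hi ⊢; omega
    rw [entry_eq σ hi, entry_eq σ hi']
    exact σ.2 ⟨i, hi⟩ ⟨-i, hi'⟩ rfl
  · have hi' : -i ∉ signedRange n := by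
      rw [mem_signedRange] at hi ⊢; omega
    rw [entry, entry, dif_neg hi, dif_neg hi', neg_zero]

theorem entry_injective {n : ℕ} (σ : SignedPerm n) {i j : ℤ} (hi : i ∈ signedRange n)
    (hj : j ∈ signedRange n) (h : entry σ i = entry σ j) : i = j := by
  rw [entry_eq σ hi, entry_eq σ hj] at h
  simpa using σ.1.injective (Subtype.ext h)

theorem entry_natAbs_injective {n : ℕ} (σ : SignedPerm n) {i j : ℕ} (hi : i ∈ Finset.Icc 1 n)
    (hj : j ∈ Finset.Icc 1 n) (h : (entry σ i).natAbs = (entry σ j).natAbs) : i = j := by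
  have hi' := natCast_mem_signedRange hi
  have hj' := natCast_mem_signedRange hj
  rcases Int.natAbs_eq_natAbs_iff.1 h with h | h
  · exact_mod_cast entry_injective σ hi' hj' h
  · rw [← entry_neg] at h
    have hj'' : -(j : ℤ) ∈ signedRange n := by
      rw [mem_signedRange] at hj' ⊢; omega
    have := entry_injective σ hi' hj'' h
    rw [Finset.mem_Icc] at hi
    omega

theorem pos_mem {n : ℕ} (σ : SignedPerm n) {k : ℕ} (hk : k ∈ Finset.Icc 1 n) :
    pos σ k ∈ Finset.Icc 1 n ∧ (entry σ (pos σ k)).natAbs = k := by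
  have hk' := natCast_mem_signedRange hk
  rw [pos, dif_pos hk']
  obtain ⟨⟨i, hi⟩, h⟩ : ∃ i, i = σ.1.symm ⟨k, hk'⟩ := ⟨_, rfl⟩
  have h1 : entry σ i = k := by
    rw [entry_eq σ hi, h]; simp
  rw [← h]
  have h2 := mem_signedRange.1 hi
  refine ⟨by rw [Finset.mem_Icc]; simp only; omega, ?_⟩
  rcases Int.natAbs_eq i with h3 | h3
  · rw [← h3, h1]; simp
  · have h4 : ((i.natAbs : ℕ) : ℤ) = -i := by omega
    rw [h4, entry_neg, h1]; simp

theorem signedPerm_ext {n : ℕ} {σ σ' : SignedPerm n}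
    (h : ∀ i ∈ Finset.Icc 1 n, entry σ (i : ℕ) = entry σ' (i : ℕ)) : σ = σ' := by
  refine Subtype.ext (Equiv.ext fun ⟨i, hi⟩ => Subtype.ext ?_)
  rw [← entry_eq, ← entry_eq]
  have h2 := mem_signedRange.1 hi
  have h3 := h i.natAbs (by rw [Finset.mem_Icc]; omega)
  rcases Int.natAbs_eq i with h4 | h4
  · rwa [← h4] at h3
  · have h5 : ((i.natAbs : ℕ) : ℤ) = -i := by omega
    rw [h5, entry_neg, entry_neg] at h3
    linarith

/-- The odd extension of `f` is an injective self-map of a finite set, hence a bijection. -/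
theorem exists_signedPerm {n : ℕ} (f : ℕ → ℤ)
    (hf : ∀ i ∈ Finset.Icc 1 n, (f i).natAbs ∈ Finset.Icc 1 n)
    (hinj : ∀ i ∈ Finset.Icc 1 n, ∀ j ∈ Finset.Icc 1 n, (f i).natAbs = (f j).natAbs → i = j) :
    ∃ σ : SignedPerm n, ∀ i ∈ Finset.Icc 1 n, entry σ (i : ℕ) = f i := by
  let g : ℤ → ℤ := fun i => if 0 < i then f i.natAbs else -f i.natAbs
  have habs : ∀ i, (g i).natAbs = (f i.natAbs).natAbs := fun i => by
    simp only [g]; split_ifs <;> simp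
  have hIcc : ∀ i ∈ signedRange n, i.natAbs ∈ Finset.Icc 1 n := fun i hi => by
    rw [mem_signedRange] at hi
    rw [Finset.mem_Icc]; omega
  have hg : ∀ i ∈ signedRange n, g i ∈ signedRange n := fun i hi => by
    have h1 := hf _ (hIcc i hi)
    rw [← habs, Finset.mem_Icc] at h1
    rw [mem_signedRange]; omega
  let G : {k : ℤ // k ∈ signedRange n} → {k : ℤ // k ∈ signedRange n} := fun i => ⟨g i, hg i i.2⟩
  have hG : Function.Injective G := by
    rintro ⟨i, hi⟩ ⟨j, hj⟩ h
    have h1 : g i = g j := congrArg Subtype.val h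
    have h2 : i.natAbs = j.natAbs :=
      hinj _ (hIcc i hi) _ (hIcc j hj) (by rw [← habs, ← habs, h1])
    have h3 := hf _ (hIcc i hi)
    rw [Finset.mem_Icc] at h3
    have h4 := mem_signedRange.1 hi
    have h5 := mem_signedRange.1 hj
    simp only [g, h2] at h1 h3
    refine Subtype.ext ?_
    simp only
    split_ifs at h1 <;> omega
  refine ⟨⟨Equiv.ofBijective G (Finite.injective_iff_bijective.1 hG), ?_⟩, ?_⟩
  · rintro ⟨i, hi⟩ ⟨j, hj⟩ h
    simp only at h
    subst h
    have h4 := mem_signedRange.1 hi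
    change g (-i) = -g i
    simp only [g, Int.natAbs_neg]
    split_ifs <;> omega
  · intro i hi
    rw [entry_eq _ (natCast_mem_signedRange hi)]
    change g i = f i
    have : 0 < (i : ℤ) := by rw [Finset.mem_Icc] at hi; omega
    simp only [g, if_pos this, Int.natAbs_natCast]

/-! ### From snakes to words with positive adjacent sums and back -/

theorem tau_add (w : ℕ → ℤ) (i : ℕ) :
    tau w i + tau w (i + 1) = (-1) ^ (i + 1) * (w i - w (i + 1)) := by
  simp only [tau, pow_succ]; ring

theorem getElem_seg (f : ℕ → ℤ) (a m i : ℕ) (hi : i < (seg f a m).length) :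
    (seg f a m)[i] = f (a + i) := by
  simp [seg]

theorem isSnakeWord_of {e n : ℕ} (he : e ≤ 1) {w : ℕ → ℤ} (zero : tau w 0 = 0)
    (last_zero : e = 1 → tau w (n + 2) = 0) (last : e = 0 → tau w (n + 1) = n + 1)
    (hmem : ∀ i ∈ Finset.Icc 1 (n + 1), absWord w i ∈ Finset.Icc 1 (n + 1))
    (hinj : ∀ i ∈ Finset.Icc 1 (n + 1), ∀ j ∈ Finset.Icc 1 (n + 1),
      absWord w i = absWord w j → i = j)
    (adj : ∀ i ≤ n + e, 0 < tau w i + tau w (i + 1)) : IsSnakeWord e n w := by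
  have hsplit : seg (tau w) 0 (n + e + 2) =
      0 :: seg (tau w) 1 (n + 1) ++ List.replicate e 0 := by
    rw [show n + e + 2 = (n + 1 + e) + 1 by ring, seg_succ, zero, ← seg_append]
    obtain rfl | rfl : e = 0 ∨ e = 1 := by omega
    · simp [seg_zero]
    · rw [seg_succ _ (0 + 1 + (n + 1)) 0, seg_zero, show 0 + 1 + (n + 1) = n + 2 by ring, last_zero rfl]
      simp
  have hIcc : ∀ i ∈ Finset.Icc 1 (n + e), i ∈ Finset.Icc 1 (n + 1) := fun i hi => by
    rw [Finset.mem_Icc] at hi ⊢; omega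
  refine ⟨⟨⟨?_, ?_, seg (tau w) 1 (n + 1), ?_, ?_⟩, ?_⟩, zero, last_zero, last,
    fun i hi => (Finset.mem_Icc.1 (hmem i (hIcc i hi))).1,
    fun i hi => (Finset.mem_Icc.1 (hmem i (hIcc i hi))).2, adj⟩
  · simp [seg_succ]
  · simp only [List.mem_singleton, forall_eq, List.isChain_iff_getElem, length_seg, getElem_seg,
      zero_add]
    intro i hi
    exact adj i (by omega)
  · simpa using hsplit
  -- n + 1 distinct values in {1, …, n + 1} exhaust this set.
  · refine List.Subperm.perm_of_length_le (List.subperm_of_subset ?_ ?_) (by simp)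
    · rw [seg, List.map_map]
      refine List.Nodup.map_on ?_ List.nodup_range'
      intro i hi j hj h
      rw [List.mem_range'_1] at hi hj
      simp only [Function.comp, natAbs_tau] at h
      exact hinj i (Finset.mem_Icc.2 (by omega)) j (Finset.mem_Icc.2 (by omega)) h
    · intro y hy
      simp only [List.mem_map, mem_seg] at hy
      obtain ⟨_, ⟨j, h1, h2, rfl⟩, rfl⟩ := hy
      have := Finset.mem_Icc.1 (hmem j (Finset.mem_Icc.2 (by omega)))
      rw [natAbs_tau, List.mem_range'_1]
      omega
  · rintro rfl
    rw [add_zero, getLast?_seg, zero_add, last rfl]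

theorem IsWord.exists_word {e n : ℕ} (he : e ≤ 1) {W : List ℤ} (hW : IsWord e n W) :
    ∃ w : ℕ → ℤ, W = seg (tau w) 0 (n + e + 2) ∧ w 0 = 0 ∧
      (e = 1 → w (n + 2) = 0) ∧ (e = 0 → w (n + 1) = (-1) ^ n * (n + 1)) ∧
      (∀ i ∈ Finset.Icc 1 (n + 1), absWord w i ∈ Finset.Icc 1 (n + 1)) ∧
      (∀ i ∈ Finset.Icc 1 (n + 1), ∀ j ∈ Finset.Icc 1 (n + 1),
        absWord w i = absWord w j → i = j) ∧
      ∀ i ≤ n + e, 0 < tau w i + tau w (i + 1) := by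
  obtain ⟨M, hM, hp⟩ := hW.eq_zero_cons
  have hMlen : M.length = n + 1 := by simpa using hp.length_eq
  have hlen : W.length = n + e + 2 := by
    rw [hM]; simp [hMlen]; ring
  have hnd : (M.map Int.natAbs).Nodup := hp.nodup_iff.2 List.nodup_range'
  have hsq : ∀ i : ℕ, ((-1 : ℤ) ^ i) * (-1) ^ i = 1 := fun i => by rw [← mul_pow]; simp
  -- The alternation of signs is an involution, so applying it to `W` inverts `tau`.
  let w : ℕ → ℤ := fun i => (-1) ^ (i + 1) * W.getD i 0
  have htau : ∀ i, tau w i = W.getD i 0 := fun i => by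
    simp only [tau, w, ← mul_assoc, hsq, one_mul]
  have hseg : W = seg (tau w) 0 (n + e + 2) := by
    refine List.ext_getElem (by simp [hlen]) fun i h1 h2 => ?_
    rw [getElem_seg, zero_add, htau, List.getD_eq_getElem _ _ h1]
  have hget : ∀ i (h1 : 1 ≤ i) (h2 : i ≤ n + 1), tau w i = M[i - 1] := by
    intro i h1 h2
    obtain ⟨j, rfl⟩ : ∃ j, i = j + 1 := ⟨i - 1, by omega⟩
    rw [htau, hM, List.cons_append, List.getD_cons_succ, List.getD_append _ _ _ _ (by omega),
      List.getD_eq_getElem _ _ (by omega)]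
    simp
  have hend : e = 1 → tau w (n + 2) = 0 := by
    rintro rfl
    rw [htau, hM, List.cons_append, List.getD_cons_succ,
      List.getD_append_right _ _ _ _ (by omega), hMlen]
    simp
  have hlast : e = 0 → tau w (n + 1) = n + 1 := by
    intro h0
    have := hW.last h0
    subst h0
    rwa [hseg, add_zero, getLast?_seg, zero_add, Option.some.injEq] at this
  have hsgn : ∀ i, w i = (-1) ^ (i + 1) * tau w i := fun i => by
    simp only [tau, ← mul_assoc, hsq, one_mul]
  refine ⟨w, hseg, ?_, fun h => ?_, fun h => ?_, ?_, ?_, ?_⟩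
  · simp [w, hM]
  · rw [hsgn, hend h, mul_zero]
  · rw [hsgn, hlast h]; ring
  · intro i hi
    rw [Finset.mem_Icc] at hi
    have : (M[i - 1]).natAbs ∈ List.range' 1 (n + 1) :=
      hp.mem_iff.1 (List.mem_map_of_mem (List.getElem_mem _))
    rw [List.mem_range'_1] at this
    rw [← natAbs_tau, hget i hi.1 hi.2, Finset.mem_Icc]
    omega
  · intro i hi j hj h
    rw [Finset.mem_Icc] at hi hj
    rw [← natAbs_tau, ← natAbs_tau, hget i hi.1 hi.2, hget j hj.1 hj.2] at h
    have := (List.Nodup.getElem_inj_iff hnd (i := i - 1) (j := j - 1)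
      (hi := by simp; omega) (hj := by simp; omega)).1 (by simpa using h)
    omega
  · intro i hi
    have := hW.config.chain W (by simp)
    rw [hseg] at this
    simp only [List.isChain_iff_getElem, length_seg, getElem_seg, zero_add] at this
    exact this i (by omega)

/-! ### The snakes with `σ₁ > 0` -/

theorem word0_last {n : ℕ} (σ : SignedPerm n) : word0 σ (n + 1) = (-1) ^ n * (n + 1) := by
  simp [word0]

theorem word0_of_le {n : ℕ} (σ : SignedPerm n) {i : ℕ} (hi : i ≤ n) : word0 σ i = entry σ i := by
  rw [word0, if_neg (by omega)]

theorem tau_word0_last {n : ℕ} (σ : SignedPerm n) : tau (word0 σ) (n + 1) = n + 1 := by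
  have h : ((-1 : ℤ) ^ n) * (-1) ^ n = 1 := by rw [← mul_pow]; simp
  rw [tau, word0_last]
  linear_combination ((n : ℤ) + 1) * h

theorem neg_one_pow_mul_pos_iff (i : ℕ) (x y : ℤ) :
    0 < (-1) ^ (i + 1) * (x - y) ↔ (Odd i → y < x) ∧ (Even i → x < y) := by
  rcases Nat.even_or_odd i with h | h
  · have h' : ¬ Odd i := by simpa using h
    rw [h.add_one.neg_one_pow]
    simp [h, h']
  · have h' : ¬ Even i := by simpa using h
    rw [h.add_one.neg_one_pow]
    simp [h, h']

theorem isSnake_iff {n : ℕ} (σ : SignedPerm n) {w : ℕ → ℤ} (hw : ∀ i ≤ n, w i = entry σ i) :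
    IsSnake σ ↔ ∀ i ∈ Finset.Ico 1 n, 0 < tau w i + tau w (i + 1) := by
  refine forall₂_congr fun i hi => ?_
  rw [Finset.mem_Ico] at hi
  rw [tau_add, neg_one_pow_mul_pos_iff, hw i (by omega), hw (i + 1) (by omega)]
  push_cast
  rfl

/-- Since `tau w 0` = 0 and `tau w 1` = σ₁, the condition σ₁ > 0 is the inequality at index 0. -/
theorem mem_snakes0_iff {n : ℕ} (σ : SignedPerm n) {w : ℕ → ℤ} (hw : ∀ i ≤ n, w i = entry σ i) :
    σ ∈ snakes0 n ↔ ∀ i < n, 0 < tau w i + tau w (i + 1) := by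
  have h0 : tau w 0 = 0 := by
    rw [tau, hw 0 (by omega), Nat.cast_zero, entry_zero, mul_zero]
  simp only [snakes0, snakes, Finset.mem_filter, Finset.mem_univ, true_and, isSnake_iff σ hw]
  have h1 : 1 ≤ n → tau w 1 = entry σ 1 := fun h => by
    rw [tau, hw 1 h]; simp
  constructor
  · rintro ⟨h2, h3⟩ i hi
    rcases Nat.eq_zero_or_pos i with rfl | hi'
    · rw [h0, zero_add, zero_add, h1 hi]
      exact h3 hi
    · exact h2 i (Finset.mem_Ico.2 ⟨hi', hi⟩)
  · intro h
    refine ⟨fun i hi => h i (Finset.mem_Ico.1 hi).2, fun hn => ?_⟩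
    have := h 0 hn
    rwa [h0, zero_add, zero_add, h1 hn] at this

theorem isSnakeWord_word0 {n : ℕ} {σ : SignedPerm n} (hσ : σ ∈ snakes0 n) :
    IsSnakeWord 0 n (word0 σ) := by
  have hlast : absWord (word0 σ) (n + 1) = n + 1 := by
    rw [← natAbs_tau, tau_word0_last]; omega
  have habs : ∀ i ∈ Finset.Icc 1 n, absWord (word0 σ) i = (entry σ i).natAbs := fun i hi => by
    rw [absWord, word0_of_le σ (Finset.mem_Icc.1 hi).2]
  have hle : ∀ i ∈ Finset.Icc 1 n, 1 ≤ absWord (word0 σ) i ∧ absWord (word0 σ) i ≤ n :=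
    fun i hi => by
      rw [habs i hi]; exact Finset.mem_Icc.1 (entry_mem σ hi)
  have hcase : ∀ i ∈ Finset.Icc 1 (n + 1), i ∈ Finset.Icc 1 n ∨ i = n + 1 := fun i hi => by
    rw [Finset.mem_Icc] at hi ⊢; omega
  have h0 : tau (word0 σ) 0 = 0 := by
    rw [tau, word0_of_le σ (Nat.zero_le _), Nat.cast_zero, entry_zero, mul_zero]
  refine isSnakeWord_of zero_le_one h0 (by simp) (fun _ => tau_word0_last σ) ?_ ?_ ?_
  · intro i hi
    rw [Finset.mem_Icc]
    rcases hcase i hi with hi | rfl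
    · have := hle i hi; omega
    · omega
  · intro i hi j hj h
    rcases hcase i hi with hi | rfl <;> rcases hcase j hj with hj | rfl
    · rw [habs i hi, habs j hj] at h
      exact entry_natAbs_injective σ hi hj h
    · have := hle i hi; omega
    · have := hle j hj; omega
    · rfl
  · intro i hi
    rcases (show i < n ∨ i = n by omega) with hi | rfl
    · exact (mem_snakes0_iff σ fun i hi => word0_of_le σ hi).1 hσ i hi
    · rw [tau_word0_last]
      rcases Nat.eq_zero_or_pos i with rfl | hi'
      · rw [h0]; simp
      · have := hle i (Finset.mem_Icc.2 ⟨hi', le_rfl⟩)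
        rw [← natAbs_tau] at this
        omega

theorem encodes_lambda1 {n : ℕ} {σ : SignedPerm n} (hσ : σ ∈ snakes0 n) :
    Encodes 0 n (seg (tau (word0 σ)) 0 (n + 2)) (lambda1 σ) := by
  intro j
  obtain ⟨h1, h2⟩ := pos_mem σ (k := j + 1) (Finset.mem_Icc.2 (by omega))
  have := (isSnakeWord_word0 hσ).isStep (k := j) h1
    (by rw [absWord, word0_of_le σ (Finset.mem_Icc.1 h1).2, h2])
  rw [lambda1, stepQ_eq]
  exact this

theorem exists_snake0 {n : ℕ} {W : List ℤ} (hW : IsWord 0 n W) :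
    ∃ σ ∈ snakes0 n, seg (tau (word0 σ)) 0 (n + 2) = W := by
  obtain ⟨w, hseg, h0, -, hlast, hmem, hinj, hadj⟩ := hW.exists_word zero_le_one
  have hn : absWord w (n + 1) = n + 1 := by
    rw [absWord, hlast rfl]
    simp [Int.natAbs_mul]; omega
  have hIcc : ∀ i ∈ Finset.Icc 1 n, i ∈ Finset.Icc 1 (n + 1) := fun i hi => by
    rw [Finset.mem_Icc] at hi ⊢; omega
  obtain ⟨σ, hσ⟩ := exists_signedPerm w
    (fun i hi => by
      have h1 := hmem i (hIcc i hi)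
      -- The value n + 1 is taken at position n + 1, so the entries at 1, …, n form a signed
      -- permutation of [n].
      have h2 : absWord w i ≠ n + 1 := fun h => by
        have := hinj i (hIcc i hi) (n + 1) (by simp) (h.trans hn.symm)
        rw [Finset.mem_Icc] at hi
        omega
      rw [absWord] at h1 h2
      rw [Finset.mem_Icc] at h1 ⊢; omega)
    (fun i hi j hj h => hinj i (hIcc i hi) j (hIcc j hj) h)
  have hw : ∀ i ≤ n, w i = entry σ i := fun i hi => by
    rcases Nat.eq_zero_or_pos i with rfl | hi'
    · rw [h0, Nat.cast_zero, entry_zero]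
    · exact (hσ i (Finset.mem_Icc.2 ⟨hi', hi⟩)).symm
  refine ⟨σ, (mem_snakes0_iff σ hw).2 fun i hi => hadj i (by omega), ?_⟩
  rw [hseg]
  refine List.map_congr_left fun i hi => ?_
  rw [List.mem_range'_1] at hi
  rw [tau, tau]
  rcases (show i ≤ n ∨ i = n + 1 by omega) with hi | rfl
  · rw [word0_of_le σ hi, hw i hi]
  · rw [word0_last, hlast rfl]

theorem tau_eq_of_seg_eq {w w' : ℕ → ℤ} {m : ℕ} (h : seg (tau w) 0 m = seg (tau w') 0 m) {i : ℕ}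
    (hi : i < m) : w i = w' i := by
  have h1 : tau w i = tau w' i := by
    have h2 := getElem_seg (tau w) 0 m i (by simpa using hi)
    simp only [h, getElem_seg, zero_add] at h2
    exact h2.symm
  exact mul_left_cancel₀ (pow_ne_zero _ (by norm_num)) h1

theorem bijOn_lambda1 (n : ℕ) : Set.BijOn (lambda1 (n := n)) (snakes0 n) (paths 0 n) := by
  refine ⟨fun σ hσ => ?_, fun σ hσ σ' hσ' h => ?_, fun z hz => ?_⟩
  · exact (encodes_lambda1 hσ).mem_paths zero_le_one (isSnakeWord_word0 hσ).isWord
  · have h1 := encodes_lambda1 hσ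
    rw [h] at h1
    have h2 := h1.injective zero_le_one (isSnakeWord_word0 hσ).isWord
      (isSnakeWord_word0 hσ').isWord (encodes_lambda1 hσ')
    refine signedPerm_ext fun i hi => ?_
    rw [Finset.mem_Icc] at hi
    have := tau_eq_of_seg_eq h2 (i := i) (by omega)
    rwa [word0_of_le σ hi.2, word0_of_le σ' hi.2] at this
  · obtain ⟨W, hW, hz⟩ := exists_encodes zero_le_one hz
    obtain ⟨σ, hσ, rfl⟩ := exists_snake0 hW
    exact ⟨σ, hσ, (encodes_lambda1 hσ).unique hz⟩

/-! ### The snakes with `σ₁ > 0` and `(-1)ⁿ σₙ < 0` -/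

theorem word00_last {n : ℕ} (σ : SignedPerm n) : word00 σ (n + 1) = 0 := by
  simp [word00]

theorem word00_of_le {n : ℕ} (σ : SignedPerm n) {i : ℕ} (hi : i ≤ n) :
    word00 σ i = entry σ i := by
  rw [word00, if_neg (by omega)]

theorem tau_word00_last {n : ℕ} (σ : SignedPerm n) : tau (word00 σ) (n + 1) = 0 := by
  rw [tau, word00_last, mul_zero]

/-- Because of the final 0, the condition on σₙ is the inequality at index n. -/
theorem mem_snakes00_iff {n : ℕ} (σ : SignedPerm n) {w : ℕ → ℤ} (hw : ∀ i ≤ n, w i = entry σ i)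
    (hlast : tau w (n + 1) = 0) :
    σ ∈ snakes00 n ↔ ∀ i ≤ n, 0 < tau w i + tau w (i + 1) := by
  rw [snakes00, Finset.mem_filter, mem_snakes0_iff σ hw]
  have h : tau w n + tau w (n + 1) = -((-1) ^ n * entry σ n) := by
    rw [hlast, tau, hw n le_rfl]; ring
  constructor
  · rintro ⟨h1, h2⟩ i hi
    rcases hi.lt_or_eq with hi | rfl
    · exact h1 i hi
    · rw [h]; omega
  · intro h1
    refine ⟨fun i hi => h1 i hi.le, ?_⟩
    have := h1 n le_rfl
    omega

theorem isSnakeWord_word00 {n : ℕ} {σ : SignedPerm (n + 1)} (hσ : σ ∈ snakes00 (n + 1)) :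
    IsSnakeWord 1 n (word00 σ) := by
  have habs : ∀ i ∈ Finset.Icc 1 (n + 1), absWord (word00 σ) i = (entry σ i).natAbs :=
    fun i hi => by rw [absWord, word00_of_le σ (Finset.mem_Icc.1 hi).2]
  refine isSnakeWord_of le_rfl ?_ (fun _ => tau_word00_last σ) (by simp) ?_ ?_ ?_
  · rw [tau, word00_of_le σ (Nat.zero_le _), Nat.cast_zero, entry_zero, mul_zero]
  · intro i hi
    rw [habs i hi]
    exact entry_mem σ hi
  · intro i hi j hj h
    rw [habs i hi, habs j hj] at h
    exact entry_natAbs_injective σ hi hj h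
  · exact (mem_snakes00_iff σ (fun i hi => word00_of_le σ hi) (tau_word00_last σ)).1 hσ

theorem encodes_lambda2 {n : ℕ} {σ : SignedPerm (n + 1)} (hσ : σ ∈ snakes00 (n + 1)) :
    Encodes 1 n (seg (tau (word00 σ)) 0 (n + 1 + 2)) (lambda2 σ) := by
  intro j
  obtain ⟨h1, h2⟩ := pos_mem σ (k := j + 1) (Finset.mem_Icc.2 (by omega))
  have := (isSnakeWord_word00 hσ).isStep (k := j) h1
    (by rw [absWord, word00_of_le σ (Finset.mem_Icc.1 h1).2, h2])
  rw [lambda2, stepR_eq]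
  exact this

theorem exists_snake00 {n : ℕ} {W : List ℤ} (hW : IsWord 1 n W) :
    ∃ σ ∈ snakes00 (n + 1), seg (tau (word00 σ)) 0 (n + 1 + 2) = W := by
  obtain ⟨w, hseg, h0, hlast, -, hmem, hinj, hadj⟩ := hW.exists_word le_rfl
  obtain ⟨σ, hσ⟩ := exists_signedPerm w hmem hinj
  have hw : ∀ i ≤ n + 1, w i = entry σ i := fun i hi => by
    rcases Nat.eq_zero_or_pos i with rfl | hi'
    · rw [h0, Nat.cast_zero, entry_zero]
    · exact (hσ i (Finset.mem_Icc.2 ⟨hi', hi⟩)).symm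
  refine ⟨σ, (mem_snakes00_iff σ hw (by rw [tau, hlast rfl, mul_zero])).2 hadj, ?_⟩
  rw [hseg]
  refine List.map_congr_left fun i hi => ?_
  rw [List.mem_range'_1] at hi
  rw [tau, tau]
  rcases (show i ≤ n + 1 ∨ i = n + 2 by omega) with hi | rfl
  · rw [word00_of_le σ hi, hw i hi]
  · rw [word00_last, hlast rfl]

theorem bijOn_lambda2 (n : ℕ) :
    Set.BijOn (lambda2 (n := n)) (snakes00 (n + 1)) (paths 1 n) := by
  refine ⟨fun σ hσ => ?_, fun σ hσ σ' hσ' h => ?_, fun z hz => ?_⟩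
  · exact (encodes_lambda2 hσ).mem_paths le_rfl (isSnakeWord_word00 hσ).isWord
  · have h1 := encodes_lambda2 hσ
    rw [h] at h1
    have h2 := h1.injective le_rfl (isSnakeWord_word00 hσ).isWord
      (isSnakeWord_word00 hσ').isWord (encodes_lambda2 hσ')
    refine signedPerm_ext fun i hi => ?_
    rw [Finset.mem_Icc] at hi
    have := tau_eq_of_seg_eq h2 (i := i) (by omega)
    rwa [word00_of_le σ hi.2, word00_of_le σ' hi.2] at this
  · obtain ⟨W, hW, hz⟩ := exists_encodes le_rfl hz
    obtain ⟨σ, hσ, rfl⟩ := exists_snake00 hW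
    exact ⟨σ, hσ, (encodes_lambda2 hσ).unique hz⟩

/-! ### The weights -/

/-- Passes from the letters, which index the steps, to the positions, which index the statistics. -/
theorem sum_pos {N : ℕ} (σ : SignedPerm N) (F : ℕ → ℤ) :
    ∑ j : Fin N, F (pos σ (j + 1)) = ∑ i ∈ Finset.Icc 1 N, F i := by
  refine Finset.sum_bij (fun j _ => pos σ (j + 1)) ?_ ?_ ?_ fun _ _ => rfl
  · intro j _
    exact (pos_mem σ (Finset.mem_Icc.2 (by omega))).1
  · intro j _ j' _ h
    have h1 := (pos_mem σ (k := j + 1) (Finset.mem_Icc.2 (by omega))).2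
    have h2 := (pos_mem σ (k := j' + 1) (Finset.mem_Icc.2 (by omega))).2
    rw [h, h2] at h1
    exact Fin.ext (by omega)
  · intro i hi
    have h1 := Finset.mem_Icc.1 (entry_mem σ hi)
    refine ⟨⟨(entry σ i).natAbs - 1, by omega⟩, Finset.mem_univ _, ?_⟩
    simp only
    rw [show (entry σ i).natAbs - 1 + 1 = (entry σ i).natAbs by omega]
    obtain ⟨h2, h3⟩ := pos_mem σ (entry_mem σ hi)
    exact entry_natAbs_injective σ h2 hi h3

theorem weightT_lambda1 {n : ℕ} {σ : SignedPerm n} (hσ : σ ∈ snakes0 n) :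
    weightT (lambda1 σ) = cs n (word0 σ) := by
  rw [weightT]
  simp only [lambda1, stepQ_eq]
  rw [sum_pos σ fun i => (stepOf 0 n (word0 σ) i).tExp]
  exact (isSnakeWord_word0 hσ).sum_tExp zero_le_one

theorem weightQ_lambda1 {n : ℕ} {σ : SignedPerm n} (hσ : σ ∈ snakes0 n) :
    weightQ (lambda1 σ) = pat231 n (absWord (word0 σ)) + patQ n (word0 σ) := by
  rw [weightQ]
  simp only [lambda1, stepQ_eq]
  rw [sum_pos σ fun i => (stepOf 0 n (word0 σ) i).qExp]
  exact (isSnakeWord_word0 hσ).sum_qExp_zero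

/-- The largest letter contributes neither to the exponent of `t` nor to that of `q`. -/
theorem stepOf_pos_last {n : ℕ} {σ : SignedPerm (n + 1)} (hσ : σ ∈ snakes00 (n + 1)) :
    (stepOf 1 (n + 1) (word00 σ) (pos σ (n + 1))).tExp = 0 ∧
      (stepOf 1 (n + 1) (word00 σ) (pos σ (n + 1))).qExp = 0 := by
  have hw := isSnakeWord_word00 hσ
  obtain ⟨h1, h2⟩ := pos_mem σ (k := n + 1) (by simp)
  have h3 : absWord (word00 σ) (pos σ (n + 1)) = n + 1 := by
    rw [absWord, word00_of_le σ (Finset.mem_Icc.1 h1).2, h2]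
  have hle : ∀ i ≤ n + 2, absWord (word00 σ) i ≤ n + 1 := fun i hi => by
    rw [← natAbs_tau]
    exact hw.isWord.abs_le (mem_seg.2 ⟨i, by omega, by omega, rfl⟩)
  have hβ := (hw.alpha_beta h1).2
  have hp : pat231At (n + 1) (absWord (word00 σ)) (pos σ (n + 1)) = 0 := by
    rw [pat231At, Finset.card_eq_zero, Finset.filter_eq_empty_iff]
    intro j hj
    rw [Finset.mem_Ioc] at hj
    have := hle j (by omega)
    omega
  rw [hp] at hβ
  rw [Finset.mem_Icc] at h1
  have h4 := hle (pos σ (n + 1) - 1) (by omega)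
  have h5 := hle (pos σ (n + 1) + 1) (by omega)
  simp only [stepOf]
  rw [if_neg (by rintro ⟨_, _⟩; omega), if_neg (by rintro ⟨_, _⟩; omega),
    if_neg (by rintro ⟨_, _⟩; omega)]
  exact ⟨rfl, hβ⟩

theorem weightT_lambda2 {n : ℕ} {σ : SignedPerm (n + 1)} (hσ : σ ∈ snakes00 (n + 1)) :
    weightT (lambda2 σ) = cs (n + 1) (word00 σ) := by
  have h := (isSnakeWord_word00 hσ).sum_tExp le_rfl (e' := 1)
  rw [← sum_pos σ fun i => (stepOf 1 (n + 1) (word00 σ) i).tExp, Fin.sum_univ_castSucc] at h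
  simp only [Fin.val_last, (stepOf_pos_last hσ).1, add_zero] at h
  rw [weightT, ← h]
  simp only [lambda2, stepR_eq]
  rfl

/-- The sum over positions adds 1 at each of n + 1 places, which is the source of -n - 1; the
largest letter, which has no step in the path, contributes exponent 0. -/
theorem weightQ_lambda2 {n : ℕ} {σ : SignedPerm (n + 1)} (hσ : σ ∈ snakes00 (n + 1)) :
    weightQ (lambda2 σ)
      = pat231 (n + 1) (absWord (word00 σ)) + patR (n + 1) (word00 σ) - n - 1 := by
  have h := (isSnakeWord_word00 hσ).sum_qExp_one
  rw [Finset.sum_add_distrib, ← sum_pos σ fun i => (stepOf 1 (n + 1) (word00 σ) i).qExp,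
    Fin.sum_univ_castSucc] at h
  simp only [Fin.val_last, (stepOf_pos_last hσ).2, add_zero] at h
  rw [← h, weightQ]
  simp only [lambda2, stepR_eq]
  simp
  ring

end SnakeEuler

namespace SnakeEuler

open Finset Polynomial

/-! ### The `q`-derivative -/

theorem qVar_sub_one_mul_tVar_ne_zero : (qVar - 1) * tVar ≠ 0 := by
  refine mul_ne_zero ?_ X_ne_zero
  rw [qVar, ← C_1, ← C_sub]
  exact C_ne_zero.2 (X_sub_C_ne_zero (1 : ℤ))

theorem qDeriv_eq {f g : ℤ[X][X]} (h : f.comp (qVar * tVar) - f = (qVar - 1) * tVar * g) :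
    qDeriv f = g :=
  mul_left_cancel₀ qVar_sub_one_mul_tVar_ne_zero ((qDeriv_spec f).symm.trans h)

theorem qDeriv_add (f g : ℤ[X][X]) : qDeriv (f + g) = qDeriv f + qDeriv g := by
  refine qDeriv_eq ?_
  rw [add_comp, mul_add, ← qDeriv_spec, ← qDeriv_spec]; ring

theorem qDeriv_C_mul (a : ℤ[X]) (f : ℤ[X][X]) : qDeriv (C a * f) = C a * qDeriv f := by
  refine qDeriv_eq ?_
  rw [mul_comp, C_comp]
  linear_combination C a * qDeriv_spec f

/-- The q-Leibniz rule: qt·f(qt) - t·f(t) = qt(f(qt) - f(t)) + (q-1)t·f(t). -/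
theorem qDeriv_tVar_mul (f : ℤ[X][X]) :
    qDeriv (tVar * f) = qVar * (tVar * qDeriv f) + f := by
  refine qDeriv_eq ?_
  rw [mul_comp, tVar, X_comp, ← tVar]
  linear_combination (qVar * tVar) * qDeriv_spec f

theorem qDeriv_one : qDeriv 1 = 0 := qDeriv_eq (by simp)

theorem qDeriv_zero : qDeriv 0 = 0 := qDeriv_eq (by simp)

/-- The `q`-integer `1 + q + ⋯ + q^(k-1)`. -/
noncomputable def qInt (k : ℕ) : ℤ[X][X] := ∑ i ∈ range k, qVar ^ i

theorem qInt_eq (k : ℕ) : qInt k = C (∑ i ∈ range k, X ^ i) := by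
  simp [qInt, qVar]

theorem qInt_zero : qInt 0 = 0 := rfl

theorem qInt_succ (k : ℕ) : qInt (k + 1) = qInt k + qVar ^ k := sum_range_succ _ _

theorem qDeriv_qInt_mul (k : ℕ) (f : ℤ[X][X]) : qDeriv (qInt k * f) = qInt k * qDeriv f := by
  rw [qInt_eq, qDeriv_C_mul]

theorem qDeriv_qVar_pow_mul (k : ℕ) (f : ℤ[X][X]) :
    qDeriv (qVar ^ k * f) = qVar ^ k * qDeriv f := by
  rw [qVar, ← C_pow, qDeriv_C_mul]

/-- The truncated k - 1 is harmless at k = 0, where the factor `qInt 0` vanishes. -/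
theorem qInt_mul_iterate (k : ℕ) (f : ℤ[X][X]) :
    qInt k * qDeriv^[k - 1] (qDeriv f) = qInt k * qDeriv^[k] f := by
  rcases k with _ | k
  · simp [qInt_zero]
  · rfl

/-- Each passage of D over t costs a factor q, and the remainders 1, q, …, q^(k-1) add up to [k]. -/
theorem iterate_qDeriv_tVar_mul (k : ℕ) (f : ℤ[X][X]) :
    qDeriv^[k] (tVar * f) = qVar ^ k * (tVar * qDeriv^[k] f) + qInt k * qDeriv^[k - 1] f := by
  induction k with
  | zero => simp [qInt_zero]
  | succ k ih =>
    have h : qInt k * qDeriv (qDeriv^[k - 1] f) = qInt k * qDeriv^[k] f := by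
      rw [← Function.iterate_succ_apply' qDeriv, Function.iterate_succ_apply, qInt_mul_iterate]
    rw [Function.iterate_succ_apply', ih, qDeriv_add, qDeriv_qVar_pow_mul, qDeriv_tVar_mul,
      qDeriv_qInt_mul, h, Nat.add_sub_cancel, Function.iterate_succ_apply' qDeriv k f, qInt_succ]
    ring

theorem iterate_qDeriv_add (k : ℕ) (f g : ℤ[X][X]) :
    qDeriv^[k] (f + g) = qDeriv^[k] f + qDeriv^[k] g := by
  induction k generalizing f g with
  | zero => rfl
  | succ k ih => simp only [Function.iterate_succ_apply, qDeriv_add, ih]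

/-- The operators `D + UDU` (`e = 0`) and `D + DUU` (`e = 1`). -/
noncomputable def stepOp (e : ℕ) (f : ℤ[X][X]) : ℤ[X][X] :=
  if e = 0 then qDeriv f + tVar * qDeriv (tVar * f) else qDeriv f + qDeriv (tVar * (tVar * f))

/-- Moving both factors t to the left of D leaves the orders h + 1, h and h - 1, which correspond to
up, level and down steps at height h. -/
theorem iterate_qDeriv_stepOp {e : ℕ} (he : e ≤ 1) (h : ℕ) (f : ℤ[X][X]) :
    qDeriv^[h] (stepOp e f) =
      (1 + tVar ^ 2 * qVar ^ (2 * h + 1 + e)) * qDeriv^[h + 1] f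
        + tVar * (qVar ^ (h + e) * qInt (h + 1) + qVar ^ h * qInt (h + e)) * qDeriv^[h] f
        + qInt h * qInt (h + e) * qDeriv^[h - 1] f := by
  obtain rfl | rfl : e = 0 ∨ e = 1 := by omega
  · rw [stepOp, if_pos rfl, iterate_qDeriv_add, ← Function.iterate_succ_apply,
      iterate_qDeriv_tVar_mul, qInt_mul_iterate, ← Function.iterate_succ_apply,
      iterate_qDeriv_tVar_mul, iterate_qDeriv_tVar_mul, Nat.succ_eq_add_one, Nat.add_sub_cancel]
    simp only [add_zero]
    ring
  · have h1 : qInt (h + 1) * qDeriv^[h] (tVar * f) = qInt (h + 1) *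
        (qVar ^ h * (tVar * qDeriv^[h] f) + qInt h * qDeriv^[h - 1] f) := by
      rw [iterate_qDeriv_tVar_mul]
    rw [stepOp, if_neg one_ne_zero, iterate_qDeriv_add, ← Function.iterate_succ_apply,
      ← Function.iterate_succ_apply, iterate_qDeriv_tVar_mul, iterate_qDeriv_tVar_mul,
      Nat.succ_eq_add_one, Nat.add_sub_cancel, h1]
    ring

/-- The generating polynomial of the weighted paths of length `n` from the height `h` to `0`. -/
noncomputable def pathPoly (e : ℕ) : ℕ → ℕ → ℤ[X][X]
  | 0, h => if h = 0 then 1 else 0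
  | n + 1, h =>
    (1 + tVar ^ 2 * qVar ^ (2 * h + 1 + e)) * qInt (h + 1) * pathPoly e n (h + 1)
      + tVar * (qVar ^ (h + e) * qInt (h + 1) + qVar ^ h * qInt (h + e)) * pathPoly e n h
      -- For e = 1 the factor `qInt (h + e)` is 1 at h = 0 and h - 1 is truncated to 0, so height 0
      -- must be excluded explicitly.
      + if h = 0 then 0 else qInt (h + e) * pathPoly e n (h - 1)

/-- Dividing by [h]! leaves the factor [h+1] on the up term and cancels the factor [h] on the down
term, which is the recursion of `pathPoly`. At n = 0, D^h 1 vanishes for h > 0. -/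
theorem iterate_qDeriv_iterate_stepOp {e : ℕ} (he : e ≤ 1) (n h : ℕ) :
    qDeriv^[h] ((stepOp e)^[n] 1) = (∏ i ∈ range h, qInt (i + 1)) * pathPoly e n h := by
  induction n generalizing h with
  | zero =>
    rcases h with _ | h
    · simp [pathPoly]
    · have : ∀ k, qDeriv^[k] 0 = 0 := fun k => Function.iterate_fixed qDeriv_zero k
      simp [pathPoly, qDeriv_one, this]
  | succ n ih =>
    rw [Function.iterate_succ_apply', iterate_qDeriv_stepOp he, ih, ih, ih, pathPoly,
      prod_range_succ]
    rcases h with _ | h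
    · simp only [qInt_zero, if_true]; ring
    · rw [if_neg (Nat.succ_ne_zero h), Nat.add_sub_cancel, prod_range_succ]
      ring

theorem polyQ_eq (n : ℕ) : polyQ n = pathPoly 0 n 0 := by
  have h := iterate_qDeriv_iterate_stepOp zero_le_one n 0
  rw [polyQ, show (fun f => qDeriv f + tVar * qDeriv (tVar * f)) = stepOp 0 from rfl]
  simpa using h

theorem polyR_eq (n : ℕ) : polyR n = pathPoly 1 n 0 := by
  have h := iterate_qDeriv_iterate_stepOp le_rfl n 0
  rw [polyR, show (fun f => qDeriv f + qDeriv (tVar * (tVar * f))) = stepOp 1 from rfl]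
  simpa using h

/-! ### Sums over paths -/

/-- The steps of a given kind with `t`-exponent `t`, indexed by the `q`-exponents from `a` on. -/
def stepEmbedding (s : StepKind) (t : ℤ) (a : ℕ) : ℕ ↪ WStep where
  toFun i := ⟨s, t, (a + i : ℕ)⟩
  inj' := by
    intro i j h
    simpa using h

theorem stepEmbedding_apply (s : StepKind) (t : ℤ) (a i : ℕ) :
    stepEmbedding s t a i = ⟨s, t, (a + i : ℕ)⟩ := rfl

/-- The steps of a given kind with `t`-exponent `t` and `m` consecutive `q`-exponents. -/
def stepRange (s : StepKind) (t : ℤ) (a m : ℕ) : Finset WStep :=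
  (range m).map (stepEmbedding s t a)

theorem mem_stepRange {s : StepKind} {t : ℤ} {a m : ℕ} {z : WStep} :
    z ∈ stepRange s t a m ↔ z.kind = s ∧ z.tExp = t ∧ (a : ℤ) ≤ z.qExp ∧ z.qExp < a + m := by
  obtain ⟨s', t', q'⟩ := z
  simp only [stepRange, mem_map, mem_range, stepEmbedding_apply, WStep.mk.injEq]
  constructor
  · rintro ⟨i, hi, rfl, rfl, rfl⟩
    exact ⟨rfl, rfl, by omega, by omega⟩
  · rintro ⟨rfl, rfl, h1, h2⟩
    exact ⟨(q' - a).toNat, by omega, rfl, rfl, by omega⟩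

/-- The weight of a step. -/
noncomputable def stepWeight (s : WStep) : ℤ[X][X] := tVar ^ s.tExp.toNat * qVar ^ s.qExp.toNat

theorem sum_stepRange (s : StepKind) (t : ℤ) (a m : ℕ) (g : StepKind → ℤ[X][X]) :
    ∑ z ∈ stepRange s t a m, stepWeight z * g z.kind
      = tVar ^ t.toNat * qVar ^ a * qInt m * g s := by
  simp only [stepRange, sum_map, stepEmbedding_apply, stepWeight, Int.toNat_natCast,
    pow_add, qInt, mul_sum, sum_mul]
  exact sum_congr rfl fun i _ => by ring

open Classical in
/-- The finite set of admissible steps at height `h`. -/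
noncomputable def stepSet (e h : ℕ) : Finset WStep :=
  stepRange .U 0 0 (h + 1) ∪ (stepRange .U 2 (2 * h + 1 + e) (h + 1) ∪
    (stepRange .L 1 (h + e) (h + 1) ∪ (stepRange .W 1 h (h + e) ∪
      if h = 0 then ∅ else stepRange .D 0 0 (h + e))))

theorem mem_stepSet {e h : ℕ} {z : WStep} : z ∈ stepSet e h ↔ Admissible e h z := by
  obtain ⟨s, t, q⟩ := z
  rcases Nat.eq_zero_or_pos h with rfl | h0
  · cases s <;> simp [stepSet, mem_stepRange, Admissible] <;> omega
  · cases s <;> simp [stepSet, mem_stepRange, Admissible, h0.ne'] <;> omega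

/-- The five families differ in the kind or in the exponent of t, so the union is disjoint. -/
theorem sum_stepSet (e h : ℕ) (g : StepKind → ℤ[X][X]) :
    ∑ z ∈ stepSet e h, stepWeight z * g z.kind =
      (1 + tVar ^ 2 * qVar ^ (2 * h + 1 + e)) * qInt (h + 1) * g .U
      + tVar * (qVar ^ (h + e) * qInt (h + 1) * g .L + qVar ^ h * qInt (h + e) * g .W)
      + if h = 0 then 0 else qInt (h + e) * g .D := by
  classical
  have hD : ∑ z ∈ (if h = 0 then ∅ else stepRange .D 0 0 (h + e)), stepWeight z * g z.kind
      = if h = 0 then 0 else qInt (h + e) * g .D := by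
    split_ifs
    · simp
    · rw [sum_stepRange]; simp
  have hk : ∀ z ∈ (if h = 0 then ∅ else stepRange .D 0 0 (h + e)), z.kind = .D := by
    intro z hz
    split_ifs at hz
    · simp at hz
    · exact (mem_stepRange.1 hz).1
  rw [stepSet, sum_union, sum_union, sum_union, sum_union, hD]
  · simp only [sum_stepRange]
    simp
    ring
  all_goals
    rw [disjoint_left]
    intro z h1 h2
    simp only [mem_union, mem_stepRange] at h1 h2
    have := hk z
    simp_all

/-- A path of length `n + 1` from its first step and the rest. -/
def consEmbedding (n : ℕ) : (Σ _ : WStep, Fin n → WStep) ↪ (Fin (n + 1) → WStep) where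
  toFun p := Fin.cons p.1 p.2
  inj' := by
    rintro ⟨s, z⟩ ⟨s', z'⟩ hp
    obtain ⟨rfl, rfl⟩ := Fin.cons_injective2 hp
    rfl

theorem consEmbedding_apply {n : ℕ} (s : WStep) (z : Fin n → WStep) :
    consEmbedding n ⟨s, z⟩ = Fin.cons s z := rfl

/-- The set of weighted paths of length `n` from the height `h` to `0`. -/
noncomputable def pathSet (e : ℕ) : (n : ℕ) → ℕ → Finset (Fin n → WStep)
  | 0, h => if h = 0 then {Fin.elim0} else ∅
  | n + 1, h => (stepSet e h).sigma (fun s => pathSet e n (h + s.kind.rise).toNat) |>.map (consEmbedding n)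

/-- Splitting off the first step gives the recursion of `pathPoly`. -/
theorem sum_pathSet (e n h : ℕ) :
    ∑ z ∈ pathSet e n h, ∏ j, stepWeight (z j) = pathPoly e n h := by
  induction n generalizing h with
  | zero => by_cases h0 : h = 0 <;> simp [pathSet, pathPoly, h0]
  | succ n ih =>
    rw [pathSet, sum_map, sum_sigma]
    simp only [consEmbedding_apply, Fin.prod_univ_succ, Fin.cons_zero, Fin.cons_succ,
      ← mul_sum, ih]
    rw [sum_stepSet e h fun s => pathPoly e n (h + s.rise).toNat, pathPoly]
    have h1 : ((h : ℤ) + StepKind.U.rise).toNat = h + 1 := by simp only [StepKind.rise]; omega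
    have h2 : ((h : ℤ) + StepKind.D.rise).toNat = h - 1 := by simp only [StepKind.rise]; omega
    have h3 : ((h : ℤ) + StepKind.L.rise).toNat = h := by simp [StepKind.rise]
    have h4 : ((h : ℤ) + StepKind.W.rise).toNat = h := by simp [StepKind.rise]
    rw [h1, h2, h3, h4]
    ring

theorem height_cons_zero {n : ℕ} (s : WStep) (z : Fin n → WStep) :
    height (Fin.cons s z : Fin (n + 1) → WStep) 0 = 0 := by
  rw [height_eq]; simp

theorem height_cons_succ {n : ℕ} (s : WStep) (z : Fin n → WStep) (j : Fin n) :
    height (Fin.cons s z : Fin (n + 1) → WStep) j.succ = s.kind.rise + height z j := by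
  rw [height_eq, height_eq, Fin.val_succ, sum_range_succ', add_comm]
  congr 1
  refine sum_congr rfl fun i hi => ?_
  have hi' : i < n := by rw [mem_range] at hi; omega
  rw [riseAt, riseAt, dif_pos (by omega), dif_pos hi']
  exact congrArg (fun s : WStep => s.kind.rise)
    (Fin.cons_succ (α := fun _ => WStep) s z ⟨i, hi'⟩)

/-- Down steps require h ≥ 1; hence `toNat` in `pathSet` never truncates. -/
theorem Admissible.rise_nonneg {e h : ℕ} {s : WStep} (hs : Admissible e h s) :
    0 ≤ h + s.kind.rise := by
  obtain ⟨κ, t, q⟩ := s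
  cases κ <;> simp [Admissible, StepKind.rise] at hs ⊢ <;> omega

theorem mem_pathSet {e n h : ℕ} {z : Fin n → WStep} :
    z ∈ pathSet e n h ↔ (∀ j, 0 ≤ h + height z j ∧ Admissible e (h + height z j) (z j)) ∧
      h + ∑ j, (z j).kind.rise = 0 := by
  induction n generalizing h with
  | zero =>
    have : z = Fin.elim0 := Subsingleton.elim _ _
    by_cases h0 : h = 0 <;> simp [pathSet, h0, this]
  | succ n ih =>
    obtain ⟨s, z, rfl⟩ : ∃ s z', z = Fin.cons s z' := ⟨z 0, Fin.tail z, (Fin.cons_self_tail z).symm⟩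
    have key : (Fin.cons s z : Fin (n + 1) → WStep) ∈ pathSet e (n + 1) h ↔
        Admissible e h s ∧ z ∈ pathSet e n (h + s.kind.rise).toNat := by
      rw [pathSet, ← consEmbedding_apply, mem_map', mem_sigma, mem_stepSet]
    rw [key, Fin.forall_fin_succ, Fin.sum_univ_succ]
    simp only [height_cons_zero, height_cons_succ, Fin.cons_zero, Fin.cons_succ, add_zero, ih]
    constructor
    · rintro ⟨h1, h2, h3⟩
      have h4 := h1.rise_nonneg
      rw [Int.toNat_of_nonneg h4] at h2 h3
      simp only [add_assoc] at h2 h3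
      exact ⟨⟨⟨by omega, h1⟩, h2⟩, h3⟩
    · rintro ⟨⟨⟨-, h1⟩, h2⟩, h3⟩
      have h4 := h1.rise_nonneg
      rw [Int.toNat_of_nonneg h4]
      simp only [add_assoc]
      exact ⟨h1, h2, h3⟩

theorem coe_pathSet (e n : ℕ) : (pathSet e n 0 : Set (Fin n → WStep)) = paths e n := by
  ext z
  simp only [mem_coe, mem_pathSet, Nat.cast_zero, zero_add, paths, IsMotzkin, Set.mem_ofPred_eq,
    forall_and]
  tauto

theorem Admissible.nonneg {e : ℕ} {h : ℤ} (hh : 0 ≤ h) {s : WStep} (hs : Admissible e h s) :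
    0 ≤ s.tExp ∧ 0 ≤ s.qExp := by
  obtain ⟨κ, t, q⟩ := s
  cases κ <;> simp [Admissible] at hs ⊢ <;> omega

theorem weightQ_nonneg {e n : ℕ} {z : Fin n → WStep} (hz : z ∈ paths e n) : 0 ≤ weightQ z :=
  sum_nonneg fun j _ => ((hz.2 j).nonneg (hz.1.1 j)).2

theorem prod_pow_toNat {ι : Type*} (s : Finset ι) (f : ι → ℤ) (hf : ∀ i ∈ s, 0 ≤ f i)
    (x : ℤ[X][X]) : ∏ i ∈ s, x ^ (f i).toNat = x ^ (∑ i ∈ s, f i).toNat := by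
  rw [prod_pow_eq_pow_sum]
  congr 1
  zify
  rw [Int.toNat_of_nonneg (sum_nonneg hf)]
  exact sum_congr rfl fun i hi => Int.toNat_of_nonneg (hf i hi)

theorem prod_stepWeight {e n : ℕ} {z : Fin n → WStep} (hz : z ∈ paths e n) :
    ∏ j, stepWeight (z j) = tVar ^ (weightT z).toNat * qVar ^ (weightQ z).toNat := by
  simp only [stepWeight, prod_mul_distrib]
  rw [prod_pow_toNat _ _ fun j _ => ((hz.2 j).nonneg (hz.1.1 j)).1,
    prod_pow_toNat _ _ fun j _ => ((hz.2 j).nonneg (hz.1.1 j)).2]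
  rfl

/-- The generating polynomial of a set in weight-preserving bijection with the set of paths. -/
theorem pathPoly_eq_sum {α : Type*} {S : Finset α} {e n : ℕ} {Λ : α → Fin n → WStep}
    (hΛ : Set.BijOn Λ S (paths e n)) (T : α → ℕ) (Q : α → ℤ)
    (hT : ∀ σ ∈ S, weightT (Λ σ) = T σ) (hQ : ∀ σ ∈ S, weightQ (Λ σ) = Q σ) :
    pathPoly e n 0 = ∑ σ ∈ S, tVar ^ T σ * qVar ^ (Q σ).toNat := by
  rw [← coe_pathSet] at hΛ
  rw [← sum_pathSet]
  refine (sum_nbij Λ hΛ.mapsTo hΛ.injOn hΛ.surjOn fun σ hσ => ?_).symm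
  have hmem : Λ σ ∈ paths e n := by
    rw [← coe_pathSet]; exact hΛ.mapsTo hσ
  rw [prod_stepWeight hmem, hT σ hσ, hQ σ hσ, Int.toNat_natCast]

theorem pathsQ_eq (n : ℕ) : pathsQ n = paths 0 n := by
  simp only [pathsQ, paths, admissibleQ_iff]

theorem pathsR_eq (n : ℕ) : pathsR n = paths 1 n := by
  simp only [pathsR, paths, admissibleR_iff]

end SnakeEuler

open SnakeEuler in
theorem theorem1p7 (n : ℕ) :
    -- the interpretation of `Q_n(t,q)`
    (((∀ σ ∈ snakes0 n,
          0 ≤ (pat231 n (absWord (word0 σ)) : ℤ) + patQ n (word0 σ)) ∧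
        polyQ n = ∑ σ ∈ snakes0 n,
          tVar ^ cs n (word0 σ) *
            qVar ^ ((pat231 n (absWord (word0 σ)) : ℤ) + patQ n (word0 σ)).toNat) ∧
      Set.BijOn (lambda1 (n := n)) (snakes0 n) (pathsQ n) ∧
      ∀ σ ∈ snakes0 n,
        weightT (lambda1 σ) = cs n (word0 σ) ∧
        weightQ (lambda1 σ) = pat231 n (absWord (word0 σ)) + patQ n (word0 σ)) ∧
    -- the interpretation of `R_n(t,q)`
    (((∀ σ ∈ snakes00 (n + 1),
          0 ≤ (pat231 (n + 1) (absWord (word00 σ)) : ℤ) + patR (n + 1) (word00 σ) - n - 1) ∧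
        polyR n = ∑ σ ∈ snakes00 (n + 1),
          tVar ^ cs (n + 1) (word00 σ) *
            qVar ^ ((pat231 (n + 1) (absWord (word00 σ)) : ℤ)
              + patR (n + 1) (word00 σ) - n - 1).toNat) ∧
      Set.BijOn (lambda2 (n := n)) (snakes00 (n + 1)) (pathsR n) ∧
      ∀ σ ∈ snakes00 (n + 1),
        weightT (lambda2 σ) = cs (n + 1) (word00 σ) ∧
        weightQ (lambda2 σ)
          = pat231 (n + 1) (absWord (word00 σ)) + patR (n + 1) (word00 σ) - n - 1) := by
  refine ⟨⟨⟨fun σ hσ => ?_, ?_⟩, ?_, fun σ hσ => ⟨weightT_lambda1 hσ, weightQ_lambda1 hσ⟩⟩,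
    ⟨⟨fun σ hσ => ?_, ?_⟩, ?_, fun σ hσ => ⟨weightT_lambda2 hσ, weightQ_lambda2 hσ⟩⟩⟩
  · rw [← weightQ_lambda1 hσ]
    exact weightQ_nonneg ((bijOn_lambda1 n).mapsTo hσ)
  · rw [polyQ_eq]
    exact pathPoly_eq_sum (bijOn_lambda1 n) _ _ (fun σ hσ => weightT_lambda1 hσ)
      fun σ hσ => weightQ_lambda1 hσ
  · rw [pathsQ_eq]
    exact bijOn_lambda1 n
  · rw [← weightQ_lambda2 hσ]
    exact weightQ_nonneg ((bijOn_lambda2 n).mapsTo hσ)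
  · rw [polyR_eq]
    exact pathPoly_eq_sum (bijOn_lambda2 n) _ _ (fun σ hσ => weightT_lambda2 hσ)
      fun σ hσ => weightQ_lambda2 hσ
  · rw [pathsR_eq]
    exact bijOn_lambda2 n
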